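/- Let $P$ be a monic complex polynomial of degree $n\ge 1$. For $t\in\mathbb R$ let $E_P(t)=\{z\in\mathbb C:\ln|P(z)|=t\}$, and let $|E_P(t)|$ denote its length (one-dimensional Hausdorff measure). Let $T(P)=\max_{P'(\zeta)=0}\ln|P(\zeta)|\in[-\infty,\infty)$ be the largest critical value of $\ln|P|$, where $\ln 0=-\infty$ (and $T(P)=-\infty$ if $n=1$, when there are no critical points), and put $$D^*=\{z\in\mathbb C:\ln|P(z)|>T(P)\},\qquad U=\{\zeta\in\mathbb C:|\zeta|>e^{T(P)/n}\},$$ with $e^{-\infty}=0$. Then there are a holomorphic function $F=P^{1/n}$ on $D^*$ (that is, $F^n=P$) with $F(z)/z\to1$ as $z\to\infty$, which maps $D^*$ bijectively onto $U$; its inverse $\varphi:U\to D^*$, so that $P(\varphi(\zeta))=\zeta^n$ for $\zeta\in U$; and a holomorphic branch of $\sqrt{\varphi'}$ on $U$ that tends to $1$ at $\infty$. Let $\sqrt{\varphi'(\zeta)}=\sum_{k\in\mathbb Z}c_k\zeta^k$ be its Laurent expansion near $\infty$. Then for every real $t\ge T(P)$ the following series converges and $$|E_P(t)|=2\pi e^{t/n}\Bigl(1+\sum_{k=2}^{\infty}|c_{-k}|^2e^{-2kt/n}\Bigr).$$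 Moreover, $$\sum_{k\ge2}|c_{-k}|^2e^{-2kT(P)/n}<+\infty,$$ which in the case $T(P)=-\infty$ (that is, $P(z)=(z-a)^n$) means that $c_{-k}=0$ for all $k\ge2$. -/

import Mathlib

open Filter Topology MeasureTheory

noncomputable section

namespace Lemniscate

/-- `ln |P(z)|`, as an extended real number (it is `-∞` at the zeros of `P`). -/
def logAbs (P : Polynomial ℂ) (z : ℂ) : EReal := ENNReal.log ‖P.eval z‖ₑ

/-- The level set `E_P(t) = {z : ln |P(z)| = t}`. -/
def levelSet (P : Polynomial ℂ) (t : ℝ) : Set ℂ := {z | logAbs P z = (t : EReal)}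

/-- The length of a subset of the plane: its one-dimensional Hausdorff measure. -/
def length (E : Set ℂ) : ENNReal := Measure.hausdorffMeasure (1 : ℝ) E

/-- The largest critical value `T(P)` of `ln |P|`. It is `-∞` when `P` vanishes at all its
critical points. -/
def maxCritValue (P : Polynomial ℂ) : EReal :=
  sSup (logAbs P '' {z | P.derivative.eval z = 0})

/-- The exterior domain `{z : ln |P(z)| > T(P)}`. -/
def extDomain (P : Polynomial ℂ) : Set ℂ := {z | maxCritValue P < logAbs P z}

/-- The exterior of the disk of radius `e^{T(P)/n}`, where `n = deg P`. -/
def extDisk (P : Polynomial ℂ) : Set ℂ :=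
  {ζ | EReal.exp (maxCritValue P / (P.natDegree : EReal)) < ‖ζ‖ₑ}

/-- `F` is the branch of `P^{1/n}` on the exterior domain, `n = deg P`, with `F(z) ~ z` at
infinity. -/
structure IsRootBranch (P : Polynomial ℂ) (F : ℂ → ℂ) : Prop where
  holo : DifferentiableOn ℂ F (extDomain P)
  pow_eq : ∀ z ∈ extDomain P, F z ^ P.natDegree = P.eval z
  asymp : Tendsto (fun z => F z / z) (Bornology.cobounded ℂ) (𝓝 1)

/-- `φ` is the inverse function of `F`, viewed as a bijection from the exterior domain
onto the exterior of the disk. -/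
structure IsInverse (P : Polynomial ℂ) (F φ : ℂ → ℂ) : Prop where
  maps_F : Set.MapsTo F (extDomain P) (extDisk P)
  maps_inv : Set.MapsTo φ (extDisk P) (extDomain P)
  left_inv : ∀ z ∈ extDomain P, φ (F z) = z
  right_inv : ∀ ζ ∈ extDisk P, F (φ ζ) = ζ

/-- `s` is the branch of `√φ'` on the exterior of the disk with `√1 = 1` at infinity. -/
structure IsSqrtDeriv (P : Polynomial ℂ) (φ s : ℂ → ℂ) : Prop where
  holo : DifferentiableOn ℂ s (extDisk P)
  sq_eq : ∀ ζ ∈ extDisk P, s ζ ^ 2 = deriv φ ζ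
  asymp : Tendsto s (Bornology.cobounded ℂ) (𝓝 1)

/-- `c k`, `k ∈ ℤ`, are the Laurent coefficients of `s` near infinity. -/
def IsLaurentAtInfty (s : ℂ → ℂ) (c : ℤ → ℂ) : Prop :=
  ∀ᶠ ζ in Bornology.cobounded ℂ, HasSum (fun k : ℤ => c k * ζ ^ k) (s ζ)

/-- `c` is the family of Laurent coefficients at infinity of `√φ'`, where `φ` is the inverse
of the branch `F` of `P^{1/n}`. -/
structure IsLaurentData (P : Polynomial ℂ) (F φ s : ℂ → ℂ) (c : ℤ → ℂ) : Prop where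
  root : IsRootBranch P F
  inverse : IsInverse P F φ
  sqrt : IsSqrtDeriv P φ s
  laurent : IsLaurentAtInfty s c

/-- The term `|c_{-k}|² e^{-2kt/n}`. -/
def term (c : ℤ → ℂ) (n : ℕ) (t : ℝ) (k : ℕ) : ℝ :=
  ‖c (-(k : ℤ))‖ ^ 2 * Real.exp (-2 * k * t / n)

end Lemniscate

end

namespace Lemniscate

/-- A continuous solution of `g ∘ f = e` is differentiable where `g' ≠ 0`. -/
theorem hasDerivAt_of_comp_left {f g e : ℂ → ℂ} {x g' e' : ℂ} (hf : ContinuousAt f x)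
    (hg : HasStrictDerivAt g g' (f x)) (hg' : g' ≠ 0) (he : HasDerivAt e e' x)
    (h : ∀ᶠ w in 𝓝 x, g (f w) = e w) : HasDerivAt f (e' / g') x := by
  have hL := hg.to_localInverse hg'
  have hx : g (f x) = e x := h.self_of_nhds
  have hleft : ∀ᶠ y in 𝓝 (f x), hg.localInverse g g' (f x) hg' (g y) = y :=
    HasStrictFDerivAt.eventually_left_inverse _
  have hev : f =ᶠ[𝓝 x] fun w => hg.localInverse g g' (f x) hg' (e w) := by
    filter_upwards [hf.eventually hleft, h] with w h1 h2
    rw [← h2, h1]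
  rw [hx] at hL
  have := hL.hasDerivAt.comp x he
  refine (this.congr_of_eventuallyEq hev).congr_deriv ?_
  field_simp

/-- If `f ∘ g` is differentiable and `g' ≠ 0`, then `f` is differentiable. -/
theorem hasDerivAt_of_comp_right {f g : ℂ → ℂ} {x g' d : ℂ} (hg : HasStrictDerivAt g g' x)
    (hg' : g' ≠ 0) (h : HasDerivAt (fun w => f (g w)) d x) : HasDerivAt f (d / g') (g x) := by
  have hL := hg.to_localInverse hg'
  have hright : ∀ᶠ y in 𝓝 (g x), g (hg.localInverse g g' x hg' y) = y :=
    HasStrictFDerivAt.eventually_right_inverse _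
  have hleft : hg.localInverse g g' x hg' (g x) = x :=
    (HasStrictFDerivAt.eventually_left_inverse (hg.hasStrictFDerivAt_equiv hg')).self_of_nhds
  have hev : f =ᶠ[𝓝 (g x)] fun y => f (g (hg.localInverse g g' x hg' y)) := by
    filter_upwards [hright] with y hy
    rw [hy]
  have h2 : HasDerivAt (fun w => f (g w)) d (hg.localInverse g g' x hg' (g x)) := by rwa [hleft]
  have := h2.comp (g x) hL.hasDerivAt
  exact (this.congr_of_eventuallyEq hev).congr_deriv (by field_simp)

/-- A continuous function with values in the `m`-th roots of unity is constant on a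
preconnected set. -/
theorem exists_eq_of_pow_eq_one {S : Set ℂ} (hS : IsPreconnected S) {h : ℂ → ℂ}
    (hc : ContinuousOn h S) {m : ℕ} (hm : m ≠ 0) (h1 : ∀ x ∈ S, h x ^ m = 1)
    {x y : ℂ} (hx : x ∈ S) (hy : y ∈ S) : h x = h y := by
  have hfin : ({z : ℂ | z ^ m = 1}).Finite := by
    have : {z : ℂ | z ^ m = 1} = {z | z ∈ Polynomial.nthRoots m (1 : ℂ)} := by
      ext z; simp [Polynomial.mem_nthRoots (Nat.pos_of_ne_zero hm)]
    rw [this]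
    exact Multiset.finite_toSet _
  exact hS.constant_of_mapsTo hfin.isDiscrete hc (T := {z : ℂ | z ^ m = 1}) (fun x hx => h1 x hx) hx hy

/-- If `h ^ m → 1` as `re w → ∞`, then `h` tends to an `m`-th root of unity. -/
theorem exists_tendsto_root_of_pow_tendsto {h : ℂ → ℂ} {m : ℕ} (hm : m ≠ 0) {M : ℝ}
    (hc : ContinuousOn h {w | M < w.re})
    (hlim : Tendsto (fun w => h w ^ m) (comap Complex.re atTop) (𝓝 1)) :
    ∃ α : ℂ, α ^ m = 1 ∧ Tendsto h (comap Complex.re atTop) (𝓝 α) := by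
  have hbasis : (comap Complex.re atTop).HasBasis (fun _ : ℝ => True) (fun a => {w | a < w.re}) :=
    (atTop_basis_Ioi' (0 : ℝ)).comap Complex.re |>.to_hasBasis
      (fun a _ => ⟨a, trivial, fun _ h => h⟩)
      (fun a _ => ⟨max a 1, lt_of_lt_of_le one_pos (le_max_right _ _),
        fun w hw => lt_of_le_of_lt (le_max_left a 1) hw⟩)
  have hev : ∀ᶠ w in comap Complex.re atTop, h w ^ m ∈ Complex.slitPlane :=
    hlim.eventually (Complex.isOpen_slitPlane.mem_nhds Complex.one_mem_slitPlane)
  obtain ⟨a, -, ha⟩ := hbasis.eventually_iff.1 hev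
  set N := max M a
  have hN : ∀ w : ℂ, N < w.re → M < w.re ∧ h w ^ m ∈ Complex.slitPlane := fun w hw =>
    ⟨lt_of_le_of_lt (le_max_left _ _) hw, ha (lt_of_le_of_lt (le_max_right _ _) hw)⟩
  set q : ℂ → ℂ := fun w => (h w ^ m) ^ ((m : ℂ)⁻¹)
  have hq : ∀ w, q w ^ m = h w ^ m := fun w => Complex.cpow_nat_inv_pow _ hm
  have hqlim : Tendsto q (comap Complex.re atTop) (𝓝 1) := by
    have : ContinuousAt (fun z : ℂ => z ^ ((m : ℂ)⁻¹)) 1 :=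
      continuousAt_cpow_const Complex.one_mem_slitPlane
    have h2 := this.tendsto.comp hlim
    rw [Complex.one_cpow] at h2
    exact h2
  have hqc : ContinuousOn q {w | N < w.re} := by
    intro w hw
    have h1 : ContinuousWithinAt (fun w => h w ^ m) {w | N < w.re} w :=
      ((hc w (hN w hw).1).mono (fun x hx => (hN x hx).1)).pow m
    have h2 : ContinuousAt (fun z : ℂ => z ^ ((m : ℂ)⁻¹)) (h w ^ m) :=
      continuousAt_cpow_const (hN w hw).2
    exact ContinuousAt.comp_continuousWithinAt (g := fun z : ℂ => z ^ ((m : ℂ)⁻¹))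
      (f := fun w => h w ^ m) h2 h1
  have hq0 : ∀ w : ℂ, N < w.re → q w ≠ 0 := by
    intro w hw h0
    have := hq w
    rw [h0, zero_pow hm] at this
    exact Complex.slitPlane_ne_zero (hN w hw).2 this.symm
  have hpre : IsPreconnected {w : ℂ | N < w.re} := (convex_halfSpace_re_gt N).isPreconnected
  have hw0 : ((N + 1 : ℝ) : ℂ) ∈ {w : ℂ | N < w.re} := by simp
  set α := h ((N + 1 : ℝ) : ℂ) / q ((N + 1 : ℝ) : ℂ)
  have hconst : ∀ w ∈ {w : ℂ | N < w.re}, h w / q w = α := fun w hw =>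
    exists_eq_of_pow_eq_one hpre (h := fun w => h w / q w) (m := m)
      ((hc.mono fun x hx => (hN x hx).1).div hqc hq0) hm
      (fun x hx => by
        rw [div_pow, hq, div_self]
        exact Complex.slitPlane_ne_zero (hN x hx).2) hw hw0
  refine ⟨α, ?_, ?_⟩
  · simp only [α]
    rw [div_pow, hq, div_self]
    exact Complex.slitPlane_ne_zero (hN _ hw0).2
  · have h3 : Tendsto (fun w => α * q w) (comap Complex.re atTop) (𝓝 (α * 1)) :=
      hqlim.const_mul α
    rw [mul_one] at h3
    refine h3.congr' ?_
    filter_upwards [hbasis.mem_of_mem (i := N) trivial] with w hw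
    rw [← hconst w hw, div_mul_cancel₀ _ (hq0 w hw)]

/-- Lifting `w ↦ exp (n w)` through a polynomial on a convex open set. -/
theorem exists_lift (P : Polynomial ℂ) (n : ℕ) {C : Set ℂ} (hC : IsOpen C) (hconv : Convex ℝ C)
    (hcrit : ∀ w ∈ C, ∀ z, P.derivative.eval z = 0 → P.eval z ≠ Complex.exp (n * w))
    {w₁ z₁ : ℂ} (hw : w₁ ∈ C) (hz : P.eval z₁ = Complex.exp (n * w₁)) :
    ∃ Φ : ℂ → ℂ, ContinuousOn Φ C ∧ (∀ w ∈ C, P.eval (Φ w) = Complex.exp (n * w)) ∧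
      Φ w₁ = z₁ := by
  classical
  have : ContractibleSpace C := hconv.contractibleSpace ⟨w₁, hw⟩
  have := hC.locallyPathConnectedSpace
  obtain ⟨f, ⟨hf0, hf⟩, -⟩ := P.isCoveringMapOn_eval.existsUnique_continuousMap_lifts
    (⟨fun w : C => Complex.exp (n * w), by fun_prop⟩ : C(C, ℂ)) (a₀ := ⟨w₁, hw⟩) (e₀ := z₁) hz
    (by rintro a ⟨z, hz, h⟩; exact hcrit a a.2 z hz h)
  refine ⟨fun w => if h : w ∈ C then f ⟨w, h⟩ else 0, ?_, ?_, ?_⟩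
  · rw [continuousOn_iff_continuous_domRestrict]
    convert! map_continuous f
    ext z; simp
  · intro w hw
    simpa [hw] using congrFun hf ⟨w, hw⟩
  · simp [hw, hf0]

/-- A lift of `w ↦ exp (n w)` through a polynomial is holomorphic. -/
theorem hasDerivAt_lift {P : Polynomial ℂ} {n : ℕ} {C : Set ℂ} (hC : IsOpen C)
    (hcrit : ∀ w ∈ C, ∀ z, P.derivative.eval z = 0 → P.eval z ≠ Complex.exp (n * w))
    {Φ : ℂ → ℂ} (hc : ContinuousOn Φ C) (hΦ : ∀ w ∈ C, P.eval (Φ w) = Complex.exp (n * w))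
    {w : ℂ} (hw : w ∈ C) :
    P.derivative.eval (Φ w) ≠ 0 ∧
    HasDerivAt Φ (n * Complex.exp (n * w) / P.derivative.eval (Φ w)) w := by
  have h0 : P.derivative.eval (Φ w) ≠ 0 := fun h => hcrit w hw _ h (hΦ w hw)
  refine ⟨h0, hasDerivAt_of_comp_left (hc.continuousAt (hC.mem_nhds hw)) (P.hasStrictDerivAt _) h0
    (e := fun w => Complex.exp (n * w)) ?_
    (Filter.eventually_of_mem (hC.mem_nhds hw) hΦ)⟩
  have := ((hasDerivAt_id w).const_mul (n : ℂ)).cexp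
  simpa [mul_comm] using this

/-- Two lifts that agree at a point agree. -/
theorem lift_unique {P : Polynomial ℂ} {n : ℕ} {C : Set ℂ} (hC : IsOpen C) (hpre : IsPreconnected C)
    (hcrit : ∀ w ∈ C, ∀ z, P.derivative.eval z = 0 → P.eval z ≠ Complex.exp (n * w))
    {Φ Ψ : ℂ → ℂ} (hc : ContinuousOn Φ C) (hΦ : ∀ w ∈ C, P.eval (Φ w) = Complex.exp (n * w))
    (hc' : ContinuousOn Ψ C) (hΨ : ∀ w ∈ C, P.eval (Ψ w) = Complex.exp (n * w))
    {w₀ : ℂ} (hw : w₀ ∈ C) (h : Φ w₀ = Ψ w₀) : Set.EqOn Φ Ψ C := by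
  have hd : DifferentiableOn ℂ Φ C := fun w hw =>
    (hasDerivAt_lift hC hcrit hc hΦ hw).2.differentiableAt.differentiableWithinAt
  have hd' : DifferentiableOn ℂ Ψ C := fun w hw =>
    (hasDerivAt_lift hC hcrit hc' hΨ hw).2.differentiableAt.differentiableWithinAt
  refine (hd.analyticOnNhd hC).eqOn_of_preconnected_of_eventuallyEq (hd'.analyticOnNhd hC) hpre hw ?_
  have h0 := (hasDerivAt_lift hC hcrit hc hΦ hw).1
  have hg := P.hasStrictDerivAt (Φ w₀)
  have hleft : ∀ᶠ y in 𝓝 (Φ w₀), hg.localInverse _ _ _ h0 (P.eval y) = y :=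
    HasStrictFDerivAt.eventually_left_inverse _
  have hΨc : Tendsto Ψ (𝓝 w₀) (𝓝 (Φ w₀)) := h ▸ (hc'.continuousAt (hC.mem_nhds hw)).tendsto
  filter_upwards [(hc.continuousAt (hC.mem_nhds hw)).eventually hleft,
    hΨc.eventually hleft, hC.mem_nhds hw] with w h1 h2 h3
  rw [← h1, ← h2, hΦ w h3, hΨ w h3]

/-- The set of `w` such that `exp w` lies in the exterior of the disk. -/
def logExtDisk (P : Polynomial ℂ) : Set ℂ :=
  {w | maxCritValue P < ((P.natDegree * w.re : ℝ) : EReal)}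

theorem logAbs_eq_of_norm_eq {P : Polynomial ℂ} {z : ℂ} {x : ℝ} (h : ‖P.eval z‖ = Real.exp x) :
    logAbs P z = (x : EReal) := by
  rw [logAbs, ← ofReal_norm, h, ENNReal.log_ofReal_of_pos (Real.exp_pos _), Real.log_exp]

theorem mem_levelSet {P : Polynomial ℂ} {z : ℂ} {t : ℝ} :
    z ∈ levelSet P t ↔ ‖P.eval z‖ = Real.exp t := by
  refine ⟨fun h => ?_, fun h => logAbs_eq_of_norm_eq h⟩
  have h1 : ENNReal.log ‖P.eval z‖ₑ = ENNReal.log (ENNReal.ofReal (Real.exp t)) := by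
    rw [ENNReal.log_ofReal_of_pos (Real.exp_pos _), Real.log_exp]; exact h
  rw [ENNReal.log_eq_iff, ← ofReal_norm,
    ENNReal.ofReal_eq_ofReal_iff (norm_nonneg _) (Real.exp_pos _).le] at h1
  exact h1

theorem norm_exp_natCast_mul (n : ℕ) (w : ℂ) : ‖Complex.exp (n * w)‖ = Real.exp (n * w.re) := by
  rw [Complex.norm_exp]; simp

theorem logAbs_eq_of_eval_eq_exp {P : Polynomial ℂ} {z w : ℂ} {n : ℕ}
    (h : P.eval z = Complex.exp (n * w)) : logAbs P z = ((n * w.re : ℝ) : EReal) :=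
  logAbs_eq_of_norm_eq (by rw [h, norm_exp_natCast_mul])

theorem mem_extDomain_iff {P : Polynomial ℂ} {z w : ℂ}
    (h : P.eval z = Complex.exp (P.natDegree * w)) : z ∈ extDomain P ↔ w ∈ logExtDisk P := by
  simp only [extDomain, logExtDisk, Set.mem_ofPred_eq, logAbs_eq_of_eval_eq_exp h]

theorem enorm_exp_eq (w : ℂ) : ‖Complex.exp w‖ₑ = EReal.exp (w.re : EReal) := by
  rw [← ofReal_norm, Complex.norm_exp, EReal.exp_coe]

theorem exp_mem_extDisk_iff {P : Polynomial ℂ} (hn : P.natDegree ≠ 0) {w : ℂ} :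
    Complex.exp w ∈ extDisk P ↔ w ∈ logExtDisk P := by
  simp only [extDisk, logExtDisk, Set.mem_ofPred_eq, enorm_exp_eq, EReal.exp_lt_exp_iff]
  rw [EReal.div_lt_iff (by exact_mod_cast Nat.pos_of_ne_zero hn) (EReal.natCast_ne_top _)]
  rw [mul_comm (P.natDegree : ℝ), EReal.coe_mul]
  rfl

theorem ne_zero_of_mem_extDisk {P : Polynomial ℂ} {ζ : ℂ} (h : ζ ∈ extDisk P) : ζ ≠ 0 := by
  rintro rfl
  simp [extDisk] at h

theorem eval_ne_zero_of_mem_extDomain {P : Polynomial ℂ} {z : ℂ} (h : z ∈ extDomain P) :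
    P.eval z ≠ 0 := by
  intro h0
  simp [extDomain, logAbs, h0] at h

theorem exists_eval_eq_exp {P : Polynomial ℂ} (hn : P.natDegree ≠ 0) {z : ℂ} (h : P.eval z ≠ 0) :
    ∃ w, P.eval z = Complex.exp (P.natDegree * w) := by
  refine ⟨Complex.log (P.eval z) / P.natDegree, ?_⟩
  rw [mul_div_cancel₀ _ (by exact_mod_cast hn), Complex.exp_log h]

theorem finite_critical {P : Polynomial ℂ} (hn : P.natDegree ≠ 0) :
    {z | P.derivative.eval z = 0}.Finite := by
  have h0 : P.derivative ≠ 0 := fun h => hn (Polynomial.derivative_eq_zero.1 h)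
  refine (Multiset.finite_toSet P.derivative.roots).subset fun z hz => ?_
  simpa [Polynomial.mem_roots h0] using hz

theorem maxCritValue_lt_top {P : Polynomial ℂ} (hn : P.natDegree ≠ 0) : maxCritValue P < ⊤ := by
  rcases ({z | P.derivative.eval z = 0}).eq_empty_or_nonempty with h | h
  · simp [maxCritValue, h]
  · have := (h.image (logAbs P)).csSup_mem ((finite_critical hn).image _)
    obtain ⟨z, -, hz⟩ := this
    rw [maxCritValue, ← hz]
    simp [logAbs]

theorem eval_ne_exp_of_critical {P : Polynomial ℂ} {w : ℂ} (hw : w ∈ logExtDisk P) {z : ℂ}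
    (hz : P.derivative.eval z = 0) : P.eval z ≠ Complex.exp (P.natDegree * w) := by
  intro h
  have h1 : logAbs P z ≤ maxCritValue P := le_sSup ⟨z, hz, rfl⟩
  rw [logAbs_eq_of_eval_eq_exp h] at h1
  exact absurd hw (not_lt.2 h1)

theorem exists_maxCritValue_lt {P : Polynomial ℂ} (hn : P.natDegree ≠ 0) :
    ∃ M : ℝ, ∀ w : ℂ, M < w.re → w ∈ logExtDisk P := by
  obtain ⟨T, h1, -⟩ := EReal.lt_iff_exists_real_btwn.1 (maxCritValue_lt_top hn)
  have hn' : (0 : ℝ) < P.natDegree := by exact_mod_cast Nat.pos_of_ne_zero hn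
  refine ⟨T / P.natDegree, fun w hw => h1.trans ?_⟩
  rw [div_lt_iff₀ hn'] at hw
  exact_mod_cast (by linarith : T < P.natDegree * w.re)

theorem mem_logExtDisk_of_re_le {P : Polynomial ℂ} {w w' : ℂ} (hw : w ∈ logExtDisk P)
    (h : w.re ≤ w'.re) : w' ∈ logExtDisk P := by
  have h1 : maxCritValue P < ((P.natDegree * w.re : ℝ) : EReal) := hw
  refine h1.trans_le ?_
  exact_mod_cast mul_le_mul_of_nonneg_left h (Nat.cast_nonneg _)

theorem isOpen_logExtDisk (P : Polynomial ℂ) : IsOpen (logExtDisk P) := by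
  have : Continuous fun w : ℂ => ((P.natDegree * w.re : ℝ) : EReal) :=
    continuous_coe_real_ereal.comp (by fun_prop)
  exact isOpen_Ioi.preimage this

theorem convex_logExtDisk (P : Polynomial ℂ) : Convex ℝ (logExtDisk P) := by
  intro x hx y hy a b ha hb hab
  have h1 : min x.re y.re ≤ (a • x + b • y).re := by
    simp only [Complex.add_re, Complex.real_smul, Complex.re_ofReal_mul]
    have e1 := mul_le_mul_of_nonneg_left (min_le_left x.re y.re) ha
    have e2 := mul_le_mul_of_nonneg_left (min_le_right x.re y.re) hb
    calc min x.re y.re = a * min x.re y.re + b * min x.re y.re := by rw [← add_mul, hab, one_mul]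
      _ ≤ _ := add_le_add e1 e2
  rcases le_total x.re y.re with h | h
  · exact mem_logExtDisk_of_re_le hx (by rwa [min_eq_left h] at h1)
  · exact mem_logExtDisk_of_re_le hy (by rwa [min_eq_right h] at h1)

theorem tendsto_eval_div_pow {P : Polynomial ℂ} (hP : P.Monic) :
    Tendsto (fun z => P.eval z / z ^ P.natDegree) (Bornology.cobounded ℂ) (𝓝 1) := by
  have h1 : Tendsto (fun z : ℂ => P.reverse.eval z⁻¹) (Bornology.cobounded ℂ) (𝓝 1) := by
    have h2 := (P.reverse.continuous.tendsto 0).comp (tendsto_inv₀_cobounded (α := ℂ))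
    have h3 : P.reverse.eval 0 = 1 := by
      rw [← Polynomial.coeff_zero_eq_eval_zero, Polynomial.coeff_zero_reverse, hP.leadingCoeff]
    rwa [h3] at h2
  refine h1.congr' ?_
  filter_upwards [Bornology.eventually_ne_cobounded (0 : ℂ)] with z hz
  have : Invertible z := invertibleOfNonzero hz
  have := Polynomial.eval₂_reverse_mul_pow (RingHom.id ℂ) z P
  rw [invOf_eq_inv] at this
  rw [eq_div_iff (pow_ne_zero _ hz)]
  exact this

theorem tendsto_cobounded_of_norm_eval {P : Polynomial ℂ} {α : Type*} {l : Filter α} {f : α → ℂ}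
    (h : Tendsto (fun x => ‖P.eval (f x)‖) l atTop) : Tendsto f l (Bornology.cobounded ℂ) := by
  rw [← tendsto_norm_atTop_iff_cobounded, tendsto_atTop]
  intro b
  obtain ⟨C, hC⟩ := (isCompact_closedBall (0 : ℂ) b).exists_bound_of_continuousOn
    P.continuous.continuousOn
  filter_upwards [h.eventually_gt_atTop C] with x hx
  by_contra! hb
  exact absurd (hC (f x) (by simpa using hb.le)) (not_le.2 hx)

/-- The parametrization `Φ w = φ (exp w)` of the exterior domain. -/
structure IsExpParam (P : Polynomial ℂ) (Φ : ℂ → ℂ) : Prop where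
  cont : ContinuousOn Φ (logExtDisk P)
  eval_eq : ∀ w ∈ logExtDisk P, P.eval (Φ w) = Complex.exp (P.natDegree * w)
  asymp : Tendsto (fun w => Φ w * Complex.exp (-w)) (comap Complex.re atTop) (𝓝 1)

theorem eventually_mem_logExtDisk {P : Polynomial ℂ} (hn : P.natDegree ≠ 0) :
    ∀ᶠ w in comap Complex.re atTop, w ∈ logExtDisk P := by
  obtain ⟨M, hM⟩ := exists_maxCritValue_lt hn
  filter_upwards [tendsto_comap.eventually (eventually_gt_atTop M)] with w hw using hM w hw

theorem tendsto_add_imaginary {a : ℂ} (ha : a.re = 0) :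
    Tendsto (fun w : ℂ => w + a) (comap Complex.re atTop) (comap Complex.re atTop) := by
  rw [tendsto_comap_iff]
  refine tendsto_comap.congr fun w => ?_
  simp [ha]

theorem exp_mul_eq_one_re {n : ℕ} (hn : n ≠ 0) {a : ℂ} (h : Complex.exp (n * a) = 1) :
    a.re = 0 := by
  have := congrArg norm h
  rw [norm_exp_natCast_mul, norm_one, Real.exp_eq_one_iff] at this
  simpa [hn] using this

theorem add_mem_logExtDisk {P : Polynomial ℂ} {w a : ℂ} (ha : a.re = 0) :
    w + a ∈ logExtDisk P ↔ w ∈ logExtDisk P := by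
  simp only [logExtDisk, Set.mem_ofPred_eq, Complex.add_re, ha, add_zero]

instance : (comap Complex.re atTop).NeBot :=
  atTop_neBot.comap_of_surj Complex.re_surjective

theorem exists_isExpParam {P : Polynomial ℂ} (hP : P.Monic) (hn : P.natDegree ≠ 0) :
    ∃ Φ, IsExpParam P Φ := by
  obtain ⟨M, hM⟩ := exists_maxCritValue_lt hn
  have hw₁ : ((M + 1 : ℝ) : ℂ) ∈ logExtDisk P := hM _ (by simp)
  set w₁ : ℂ := ((M + 1 : ℝ) : ℂ)
  have hdeg : (P - Polynomial.C (Complex.exp (P.natDegree * w₁))).degree ≠ 0 := by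
    intro h
    have := Polynomial.natDegree_eq_of_degree_eq_some h
    rw [Polynomial.natDegree_sub_C] at this
    exact hn this
  obtain ⟨z₁, hz₁⟩ := IsAlgClosed.exists_root _ hdeg
  have hz : P.eval z₁ = Complex.exp (P.natDegree * w₁) := by
    simpa [Polynomial.IsRoot, sub_eq_zero] using hz₁
  obtain ⟨Φ, hc, hev, -⟩ := exists_lift P P.natDegree (isOpen_logExtDisk P) (convex_logExtDisk P)
    (fun w hw z h => eval_ne_exp_of_critical hw h) hw₁ hz
  have hnorm : Tendsto (fun w => ‖P.eval (Φ w)‖) (comap Complex.re atTop) atTop := by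
    have h1 : Tendsto (fun w : ℂ => Real.exp (P.natDegree * w.re)) (comap Complex.re atTop) atTop :=
      Real.tendsto_exp_atTop.comp (tendsto_comap.const_mul_atTop
        (by exact_mod_cast Nat.pos_of_ne_zero hn))
    refine h1.congr' ?_
    filter_upwards [eventually_mem_logExtDisk hn] with w hw
    rw [hev w hw, norm_exp_natCast_mul]
  have hlim : Tendsto (fun w => (Φ w * Complex.exp (-w)) ^ P.natDegree)
      (comap Complex.re atTop) (𝓝 1) := by
    have h1 := ((tendsto_eval_div_pow hP).comp (tendsto_cobounded_of_norm_eval hnorm)).inv₀ one_ne_zero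
    rw [inv_one] at h1
    refine h1.congr' ?_
    filter_upwards [eventually_mem_logExtDisk hn] with w hw
    simp only [Function.comp]
    rw [hev w hw, inv_div, mul_pow, ← Complex.exp_nat_mul, mul_neg, Complex.exp_neg, div_eq_mul_inv]
  obtain ⟨α, hα, hlimα⟩ := exists_tendsto_root_of_pow_tendsto hn (M := M)
    ((hc.mono fun w hw => hM w hw).mul (by fun_prop)) hlim
  have hα0 : α ≠ 0 := by
    rintro rfl
    rw [zero_pow hn] at hα
    exact zero_ne_one hα
  have hexp : Complex.exp (P.natDegree * Complex.log α⁻¹) = 1 := by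
    rw [Complex.exp_nat_mul, Complex.exp_log (inv_ne_zero hα0), inv_pow, hα, inv_one]
  have hre := exp_mul_eq_one_re hn hexp
  refine ⟨fun w => Φ (w + Complex.log α⁻¹), ⟨?_, ?_, ?_⟩⟩
  · exact hc.comp (by fun_prop) fun w hw => (add_mem_logExtDisk hre).2 hw
  · intro w hw
    rw [hev _ ((add_mem_logExtDisk hre).2 hw), mul_add, Complex.exp_add, hexp, mul_one]
  · have h1 := (hlimα.comp (tendsto_add_imaginary hre)).mul_const α⁻¹
    rw [mul_inv_cancel₀ hα0] at h1
    refine h1.congr fun w => ?_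
    simp only [Function.comp, Pi.mul_apply]
    rw [neg_add, Complex.exp_add, Complex.exp_neg (Complex.log _), Complex.exp_log (inv_ne_zero hα0),
      inv_inv, mul_assoc, mul_assoc, mul_inv_cancel₀ hα0, mul_one]

namespace IsExpParam

variable {P : Polynomial ℂ} {Φ : ℂ → ℂ}

theorem exp_eq_exp_of_eq (h : IsExpParam P Φ) (hn : P.natDegree ≠ 0) {w w' : ℂ}
    (hw : w ∈ logExtDisk P) (hw' : w' ∈ logExtDisk P) (heq : Φ w = Φ w') :
    Complex.exp w = Complex.exp w' := by
  have hexp : Complex.exp (P.natDegree * (w' - w)) = 1 := by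
    rw [mul_sub, Complex.exp_sub, ← h.eval_eq _ hw, ← h.eval_eq _ hw', heq, div_self]
    rw [h.eval_eq _ hw']; exact Complex.exp_ne_zero _
  have hre := exp_mul_eq_one_re hn hexp
  have hEq : Set.EqOn (fun x => Φ (x + (w' - w))) Φ (logExtDisk P) := by
    refine lift_unique (n := P.natDegree) (isOpen_logExtDisk P) (convex_logExtDisk P).isPreconnected
      (fun w hw z h => eval_ne_exp_of_critical hw h) ?_ ?_ h.cont h.eval_eq hw ?_
    · exact h.cont.comp (by fun_prop) fun w hw => (add_mem_logExtDisk hre).2 hw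
    · intro w hw
      rw [h.eval_eq _ ((add_mem_logExtDisk hre).2 hw), mul_add, Complex.exp_add, hexp, mul_one]
    · simp [heq]
  have h1 := (h.asymp.comp (tendsto_add_imaginary hre)).mul_const (Complex.exp (w' - w))
  have h2 : Tendsto (fun x => Φ x * Complex.exp (-x)) (comap Complex.re atTop)
      (𝓝 (1 * Complex.exp (w' - w))) := by
    refine h1.congr' ?_
    filter_upwards [eventually_mem_logExtDisk hn] with x hx
    simp only [Function.comp]
    have h3 := hEq hx
    simp only at h3
    rw [h3, neg_add, Complex.exp_add, Complex.exp_neg (w' - w), mul_assoc, mul_assoc,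
      inv_mul_cancel₀ (Complex.exp_ne_zero _), mul_one]
  have h3 := tendsto_nhds_unique h2 h.asymp
  rw [one_mul, Complex.exp_sub, div_eq_one_iff_eq (Complex.exp_ne_zero _)] at h3
  exact h3.symm

theorem exp_mul_rotate {n : ℕ} (hn : n ≠ 0) (k : ℕ) :
    Complex.exp (n * (2 * Real.pi * Complex.I * (k / n))) = 1 := by
  have : (n : ℂ) * (2 * Real.pi * Complex.I * (k / n)) = (k : ℤ) * (2 * Real.pi * Complex.I) := by
    have : (n : ℂ) ≠ 0 := by exact_mod_cast hn
    push_cast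
    field_simp
  rw [this, Complex.exp_int_mul_two_pi_mul_I]

theorem exp_rotate_inj {n : ℕ} (hn : n ≠ 0) {k l : ℕ} (hk : k < n) (hl : l < n)
    (h : Complex.exp (2 * Real.pi * Complex.I * (k / n)) =
      Complex.exp (2 * Real.pi * Complex.I * (l / n))) : k = l := by
  have hprim := Complex.isPrimitiveRoot_exp n hn
  refine hprim.pow_inj hk hl ?_
  rw [← Complex.exp_nat_mul, ← Complex.exp_nat_mul]
  convert h using 2 <;> ring

theorem rotate_re {n : ℕ} (hn : n ≠ 0) (k : ℕ) :
    (2 * Real.pi * Complex.I * (k / n) : ℂ).re = 0 :=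
  exp_mul_eq_one_re hn (exp_mul_rotate hn k)

end IsExpParam

/-- If `n = deg P` solutions of `P = v` are pairwise distinct, then they are all the roots of `P - v`. -/
theorem exists_rotate_of_injOn {P : Polynomial ℂ} (hn : P.natDegree ≠ 0) {f : ℕ → ℂ} {v : ℂ}
    (hf : ∀ k < P.natDegree, P.eval (f k) = v)
    (hinj : ∀ k < P.natDegree, ∀ l < P.natDegree, f k = f l → k = l) {z : ℂ} (hz : P.eval z = v) :
    ∃ k < P.natDegree, f k = z := by
  classical
  set Q := P - Polynomial.C v
  have hQdeg : Q.natDegree = P.natDegree := Polynomial.natDegree_sub_C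
  have hQ : Q ≠ 0 := by
    intro h
    rw [h, Polynomial.natDegree_zero] at hQdeg
    exact hn hQdeg.symm
  have hmem : ∀ y, P.eval y = v → y ∈ Q.roots.toFinset := fun y hy => by
    simp [Polynomial.mem_roots hQ, Q, Polynomial.IsRoot, hy]
  have hsub : (Finset.range P.natDegree).image f ⊆ Q.roots.toFinset := by
    intro y hy
    obtain ⟨k, hk, rfl⟩ := Finset.mem_image.1 hy
    exact hmem _ (hf k (Finset.mem_range.1 hk))
  have hcard : ((Finset.range P.natDegree).image f).card = P.natDegree := by
    rw [Finset.card_image_of_injOn, Finset.card_range]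
    intro k hk l hl hkl
    exact hinj k (by simpa using hk) l (by simpa using hl) hkl
  have heq := Finset.eq_of_subset_of_card_le hsub (by
    rw [hcard, ← hQdeg]
    exact (Multiset.toFinset_card_le _).trans (Polynomial.card_roots' _))
  have := hmem z hz
  rw [← heq] at this
  obtain ⟨k, hk, h⟩ := Finset.mem_image.1 this
  exact ⟨k, Finset.mem_range.1 hk, h⟩

namespace IsExpParam

variable {P : Polynomial ℂ} {Φ : ℂ → ℂ}

theorem exists_rotate_eq (h : IsExpParam P Φ) (hn : P.natDegree ≠ 0) {w z : ℂ}
    (hw : w ∈ logExtDisk P) (hz : P.eval z = Complex.exp (P.natDegree * w)) :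
    ∃ k < P.natDegree, Φ (w + 2 * Real.pi * Complex.I * (k / P.natDegree)) = z := by
  refine exists_rotate_of_injOn hn (f := fun k => Φ (w + 2 * Real.pi * Complex.I * (k / P.natDegree)))
    (fun k _ => ?_) (fun k hk l hl hkl => ?_) hz
  · rw [h.eval_eq _ ((add_mem_logExtDisk (rotate_re hn k)).2 hw), mul_add, Complex.exp_add,
      exp_mul_rotate hn, mul_one]
  · have := h.exp_eq_exp_of_eq hn ((add_mem_logExtDisk (rotate_re hn k)).2 hw)
      ((add_mem_logExtDisk (rotate_re hn l)).2 hw) hkl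
    rw [Complex.exp_add, Complex.exp_add] at this
    exact exp_rotate_inj hn hk hl (mul_left_cancel₀ (Complex.exp_ne_zero _) this)

theorem eq_iff (h : IsExpParam P Φ) (hn : P.natDegree ≠ 0) {w w' : ℂ}
    (hw : w ∈ logExtDisk P) (hw' : w' ∈ logExtDisk P) :
    Φ w = Φ w' ↔ Complex.exp w = Complex.exp w' := by
  refine ⟨h.exp_eq_exp_of_eq hn hw hw', fun he => ?_⟩
  have hz : P.eval (Φ w') = Complex.exp (P.natDegree * w) := by
    rw [h.eval_eq _ hw', Complex.exp_nat_mul, Complex.exp_nat_mul, he]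
  obtain ⟨k, hk, hk'⟩ := h.exists_rotate_eq hn hw hz
  have h1 := h.exp_eq_exp_of_eq hn ((add_mem_logExtDisk (rotate_re hn k)).2 hw) hw' hk'
  rw [← he, Complex.exp_add] at h1
  have h2 : Complex.exp (2 * Real.pi * Complex.I * (k / P.natDegree)) =
      Complex.exp (2 * Real.pi * Complex.I * ((0 : ℕ) / P.natDegree)) := by
    simpa using h1
  have := exp_rotate_inj hn hk (Nat.pos_of_ne_zero hn) h2
  subst this
  simpa using hk'

theorem mem_extDomain (h : IsExpParam P Φ) {w : ℂ} (hw : w ∈ logExtDisk P) :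
    Φ w ∈ extDomain P := (mem_extDomain_iff (h.eval_eq w hw)).2 hw

theorem exists_eq (h : IsExpParam P Φ) (hn : P.natDegree ≠ 0) {z : ℂ} (hz : z ∈ extDomain P) :
    ∃ w ∈ logExtDisk P, Φ w = z := by
  obtain ⟨w, hw⟩ := exists_eval_eq_exp hn (eval_ne_zero_of_mem_extDomain hz)
  have hw' := (mem_extDomain_iff hw).1 hz
  obtain ⟨k, -, hk⟩ := h.exists_rotate_eq hn hw' hw
  exact ⟨_, (add_mem_logExtDisk (rotate_re hn k)).2 hw', hk⟩

theorem hasDerivAt (h : IsExpParam P Φ) {w : ℂ} (hw : w ∈ logExtDisk P) :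
    P.derivative.eval (Φ w) ≠ 0 ∧
    HasDerivAt Φ (P.natDegree * Complex.exp (P.natDegree * w) / P.derivative.eval (Φ w)) w :=
  hasDerivAt_lift (isOpen_logExtDisk P) (fun _ hw _ h => eval_ne_exp_of_critical hw h) h.cont
    h.eval_eq hw

end IsExpParam

theorem log_mem_logExtDisk {P : Polynomial ℂ} (hn : P.natDegree ≠ 0) {ζ : ℂ} (h : ζ ∈ extDisk P) :
    Complex.log ζ ∈ logExtDisk P := by
  rw [← exp_mem_extDisk_iff hn, Complex.exp_log (ne_zero_of_mem_extDisk h)]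
  exact h

theorem image_exp_logExtDisk {P : Polynomial ℂ} (hn : P.natDegree ≠ 0) :
    Complex.exp '' logExtDisk P = extDisk P := by
  ext ζ
  constructor
  · rintro ⟨w, hw, rfl⟩
    exact (exp_mem_extDisk_iff hn).2 hw
  · intro h
    exact ⟨Complex.log ζ, log_mem_logExtDisk hn h, Complex.exp_log (ne_zero_of_mem_extDisk h)⟩

theorem isOpen_extDisk {P : Polynomial ℂ} (hn : P.natDegree ≠ 0) : IsOpen (extDisk P) := by
  rw [← image_exp_logExtDisk hn]
  exact Complex.isOpenMap_exp _ (isOpen_logExtDisk P)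

theorem isPreconnected_extDisk {P : Polynomial ℂ} (hn : P.natDegree ≠ 0) :
    IsPreconnected (extDisk P) := by
  rw [← image_exp_logExtDisk hn]
  exact (convex_logExtDisk P).isPreconnected.image _ Complex.continuous_exp.continuousOn

theorem eventually_mem_extDisk {P : Polynomial ℂ} (hn : P.natDegree ≠ 0) :
    ∀ᶠ ζ in Bornology.cobounded ℂ, ζ ∈ extDisk P := by
  obtain ⟨M, hM⟩ := exists_maxCritValue_lt hn
  have := tendsto_norm_cobounded_atTop (E := ℂ)
  filter_upwards [this.eventually_gt_atTop (Real.exp M), Bornology.eventually_ne_cobounded 0]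
    with ζ h1 h2
  rw [← Complex.exp_log h2, exp_mem_extDisk_iff hn]
  apply hM
  rw [Complex.log_re]
  exact (Real.lt_log_iff_exp_lt (norm_pos_iff.2 h2)).2 h1

theorem eventually_mem_extDomain {P : Polynomial ℂ} (hn : P.natDegree ≠ 0) :
    ∀ᶠ z in Bornology.cobounded ℂ, z ∈ extDomain P := by
  obtain ⟨M, hM⟩ := exists_maxCritValue_lt hn
  have hdeg : 0 < P.degree := Polynomial.natDegree_pos_iff_degree_pos.1 (Nat.pos_of_ne_zero hn)
  have := P.tendsto_norm_atTop hdeg (tendsto_norm_cobounded_atTop (E := ℂ))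
  filter_upwards [this.eventually_gt_atTop (Real.exp (P.natDegree * M))] with z hz
  have h0 : P.eval z ≠ 0 := norm_pos_iff.1 ((Real.exp_pos _).trans hz)
  obtain ⟨w, hw⟩ := exists_eval_eq_exp hn h0
  refine (mem_extDomain_iff hw).2 (hM w ?_)
  rw [hw, norm_exp_natCast_mul, Real.exp_lt_exp] at hz
  exact lt_of_mul_lt_mul_left hz (Nat.cast_nonneg _)

theorem tendsto_log_cobounded :
    Tendsto Complex.log (Bornology.cobounded ℂ) (comap Complex.re atTop) := by
  rw [tendsto_comap_iff]
  exact (Real.tendsto_log_atTop.comp (tendsto_norm_cobounded_atTop (E := ℂ))).congr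
    fun ζ => (Complex.log_re ζ).symm

/-- `φ` is a conformal bijection from the exterior disk onto the exterior domain with
`P (φ ζ) = ζ ^ n` and `φ ζ ~ ζ`. -/
structure IsExteriorMap (P : Polynomial ℂ) (φ : ℂ → ℂ) : Prop where
  eval_eq : ∀ ζ ∈ extDisk P, P.eval (φ ζ) = ζ ^ P.natDegree
  bijOn : Set.BijOn φ (extDisk P) (extDomain P)
  deriv_ne : ∀ ζ ∈ extDisk P, P.derivative.eval (φ ζ) ≠ 0
  hasDerivAt : ∀ ζ ∈ extDisk P,
    HasDerivAt φ (P.natDegree * ζ ^ (P.natDegree - 1) / P.derivative.eval (φ ζ)) ζ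
  asymp : Tendsto (fun ζ => φ ζ / ζ) (Bornology.cobounded ℂ) (𝓝 1)

theorem IsExpParam.isExteriorMap {P : Polynomial ℂ} {Φ : ℂ → ℂ} (h : IsExpParam P Φ)
    (hn : P.natDegree ≠ 0) : IsExteriorMap P (fun ζ => Φ (Complex.log ζ)) where
  eval_eq ζ hζ := by
    rw [h.eval_eq _ (log_mem_logExtDisk hn hζ), Complex.exp_nat_mul,
      Complex.exp_log (ne_zero_of_mem_extDisk hζ)]
  bijOn := by
    refine ⟨fun ζ hζ => h.mem_extDomain (log_mem_logExtDisk hn hζ), fun ζ hζ ξ hξ he => ?_,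
      fun z hz => ?_⟩
    · have := (h.eq_iff hn (log_mem_logExtDisk hn hζ) (log_mem_logExtDisk hn hξ)).1 he
      rwa [Complex.exp_log (ne_zero_of_mem_extDisk hζ),
        Complex.exp_log (ne_zero_of_mem_extDisk hξ)] at this
    · obtain ⟨w, hw, rfl⟩ := h.exists_eq hn hz
      have hw' := (exp_mem_extDisk_iff hn).2 hw
      refine ⟨Complex.exp w, hw', ?_⟩
      exact (h.eq_iff hn (log_mem_logExtDisk hn hw') hw).2
        (Complex.exp_log (Complex.exp_ne_zero w))
  deriv_ne ζ hζ := (h.hasDerivAt (log_mem_logExtDisk hn hζ)).1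
  hasDerivAt ζ hζ := by
    have hw := log_mem_logExtDisk hn hζ
    have hζ0 := ne_zero_of_mem_extDisk hζ
    have h1 := (h.hasDerivAt hw).2
    have h2 : HasDerivAt (fun w => (fun ζ => Φ (Complex.log ζ)) (Complex.exp w)) _ (Complex.log ζ) :=
      h1.congr_of_eventuallyEq (by
        filter_upwards [(isOpen_logExtDisk P).mem_nhds hw] with w hw'
        have hw'' := log_mem_logExtDisk hn ((exp_mem_extDisk_iff hn).2 hw')
        exact (h.eq_iff hn hw'' hw').2 (Complex.exp_log (Complex.exp_ne_zero w)))
    have h3 := hasDerivAt_of_comp_right (f := fun ζ => Φ (Complex.log ζ))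
      (Complex.hasStrictDerivAt_exp (Complex.log ζ))
      (Complex.exp_ne_zero _) h2
    rw [Complex.exp_nat_mul, Complex.exp_log hζ0] at h3
    refine h3.congr_deriv ?_
    obtain ⟨k, hk⟩ := Nat.exists_eq_succ_of_ne_zero hn
    rw [hk, Nat.succ_sub_one, pow_succ]
    field_simp
  asymp := by
    refine (h.asymp.comp tendsto_log_cobounded).congr' ?_
    filter_upwards [Bornology.eventually_ne_cobounded 0] with ζ hζ
    simp only [Function.comp]
    rw [Complex.exp_neg, Complex.exp_log hζ, div_eq_mul_inv]

namespace IsExteriorMap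

variable {P : Polynomial ℂ} {φ : ℂ → ℂ}

theorem differentiableOn (h : IsExteriorMap P φ) : DifferentiableOn ℂ φ (extDisk P) :=
  fun ζ hζ => (h.hasDerivAt ζ hζ).differentiableAt.differentiableWithinAt

theorem deriv_eq (h : IsExteriorMap P φ) {ζ : ℂ} (hζ : ζ ∈ extDisk P) :
    deriv φ ζ = P.natDegree * ζ ^ (P.natDegree - 1) / P.derivative.eval (φ ζ) :=
  (h.hasDerivAt ζ hζ).deriv

theorem deriv_ne_zero (h : IsExteriorMap P φ) (hn : P.natDegree ≠ 0) {ζ : ℂ} (hζ : ζ ∈ extDisk P) :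
    deriv φ ζ ≠ 0 := by
  rw [h.deriv_eq hζ]
  exact div_ne_zero (mul_ne_zero (by exact_mod_cast hn)
    (pow_ne_zero _ (ne_zero_of_mem_extDisk hζ))) (h.deriv_ne ζ hζ)

theorem isPreconnected_extDomain (h : IsExteriorMap P φ) (hn : P.natDegree ≠ 0) :
    IsPreconnected (extDomain P) := by
  rw [← h.bijOn.image_eq]
  exact (isPreconnected_extDisk hn).image _ h.differentiableOn.continuousOn

theorem exists_rootBranch (h : IsExteriorMap P φ) (hn : P.natDegree ≠ 0) :
    ∃ F, IsRootBranch P F ∧ IsInverse P F φ := by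
  set F := Function.invFunOn φ (extDisk P)
  have hinv : Set.InvOn F φ (extDisk P) (extDomain P) := h.bijOn.invOn_invFunOn
  have hmaps : Set.MapsTo F (extDomain P) (extDisk P) := fun z hz => by
    exact Function.invFunOn_mem (h.bijOn.surjOn hz)
  have hpow : ∀ z ∈ extDomain P, F z ^ P.natDegree = P.eval z := fun z hz => by
    rw [← h.eval_eq _ (hmaps hz), hinv.2 hz]
  refine ⟨F, ⟨?_, hpow, ?_⟩, ⟨hmaps, h.bijOn.mapsTo, hinv.2, hinv.1⟩⟩
  · intro z hz
    obtain ⟨ζ, hζ, rfl⟩ := h.bijOn.surjOn hz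
    have hopen := isOpen_extDisk hn
    have h1 : HasStrictDerivAt φ (deriv φ ζ) ζ :=
      ((h.differentiableOn.analyticOnNhd hopen) ζ hζ).hasStrictDerivAt
    have h2 : HasDerivAt (fun w => F (φ w)) 1 ζ := (hasDerivAt_id ζ).congr_of_eventuallyEq (by
      filter_upwards [hopen.mem_nhds hζ] with w hw using hinv.1 hw)
    exact (hasDerivAt_of_comp_right h1 (h.deriv_ne_zero hn hζ) h2).differentiableAt.differentiableWithinAt
  · have hF := eventually_mem_extDomain hn
    have hdeg : 0 < P.degree := Polynomial.natDegree_pos_iff_degree_pos.1 (Nat.pos_of_ne_zero hn)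
    have hFlim : Tendsto F (Bornology.cobounded ℂ) (Bornology.cobounded ℂ) := by
      refine tendsto_cobounded_of_norm_eval (P := Polynomial.X ^ P.natDegree) ?_
      refine (P.tendsto_norm_atTop hdeg (tendsto_norm_cobounded_atTop (E := ℂ))).congr' ?_
      filter_upwards [hF] with z hz
      simp [hpow z hz]
    have := (h.asymp.comp hFlim).inv₀ one_ne_zero
    rw [inv_one] at this
    refine this.congr' ?_
    filter_upwards [hF] with z hz
    simp only [Function.comp]
    rw [hinv.2 hz, inv_div]

end IsExteriorMap

theorem IsRootBranch.eqOn {P : Polynomial ℂ} {F G : ℂ → ℂ} (hn : P.natDegree ≠ 0)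
    (hD : IsPreconnected (extDomain P))
    (hF : IsRootBranch P F) (hG : IsRootBranch P G) : Set.EqOn F G (extDomain P) := by
  have hG0 : ∀ z ∈ extDomain P, G z ≠ 0 := fun z hz h0 =>
    eval_ne_zero_of_mem_extDomain hz (by rw [← hG.pow_eq z hz, h0, zero_pow hn])
  intro z hz
  have hconst : ∀ x ∈ extDomain P, F x / G x = F z / G z := fun x hx =>
    exists_eq_of_pow_eq_one hD (h := fun x => F x / G x) (m := P.natDegree)
      (hF.holo.continuousOn.div hG.holo.continuousOn hG0) hn
      (fun x hx => by
        rw [div_pow, hF.pow_eq x hx, hG.pow_eq x hx, div_self (eval_ne_zero_of_mem_extDomain hx)])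
      hx hz
  have hlim := hF.asymp.div hG.asymp one_ne_zero
  rw [div_one] at hlim
  have h2 : Tendsto (fun _ : ℂ => F z / G z) (Bornology.cobounded ℂ) (𝓝 1) := by
    refine hlim.congr' ?_
    filter_upwards [eventually_mem_extDomain hn, Bornology.eventually_ne_cobounded 0] with x hx h0
    simp only [Pi.div_apply]
    rw [div_div_div_cancel_right₀ h0, hconst x hx]
  have h3 := tendsto_nhds_unique h2 tendsto_const_nhds
  exact (div_eq_one_iff_eq (hG0 z hz)).1 h3.symm

/-- The image of the exterior of the disk under `ζ ↦ 1 / ζ`, with the point `0` added. -/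
def invDisk (P : Polynomial ℂ) : Set ℂ :=
  Metric.eball 0 (EReal.exp (maxCritValue P / (P.natDegree : EReal)))⁻¹

theorem mem_invDisk_iff {P : Polynomial ℂ} {u : ℂ} (hu : u ≠ 0) :
    u ∈ invDisk P ↔ u⁻¹ ∈ extDisk P := by
  simp only [invDisk, extDisk, Set.mem_ofPred_eq, Metric.mem_eball, edist_zero_right,
    enorm_inv hu]
  rw [ENNReal.lt_inv_iff_lt_inv]

theorem isOpen_invDisk (P : Polynomial ℂ) : IsOpen (invDisk P) := Metric.isOpen_eball

theorem zero_mem_invDisk {P : Polynomial ℂ} (hn : P.natDegree ≠ 0) : 0 ∈ invDisk P := by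
  obtain ⟨ζ, hζ⟩ := (eventually_mem_extDisk (P := P) hn).exists
  have h1 := (mem_invDisk_iff (P := P) (inv_ne_zero (ne_zero_of_mem_extDisk hζ))).2
    (by rwa [inv_inv])
  exact Metric.mem_eball_self (pos_of_gt h1)

theorem convex_invDisk (P : Polynomial ℂ) : Convex ℝ (invDisk P) := convex_eball _ _

namespace IsExteriorMap

variable {P : Polynomial ℂ} {φ : ℂ → ℂ}

theorem exists_sqrt_at_zero (h : IsExteriorMap P φ) (hn : P.natDegree ≠ 0) :
    ∃ g : ℂ → ℂ, DifferentiableOn ℂ g (invDisk P) ∧ g 0 = 1 ∧ deriv g 0 = 0 ∧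
      ∀ u ∈ invDisk P, u ≠ 0 → g u ^ 2 = deriv φ u⁻¹ := by
  have h0 := zero_mem_invDisk hn
  have hopen := isOpen_invDisk P
  set k : ℂ → ℂ := Function.update (fun u => u * φ u⁻¹) 0 1
  have hk0 : k 0 = 1 := Function.update_self ..
  have hk : ∀ u ≠ 0, k u = u * φ u⁻¹ := fun u hu => Function.update_of_ne hu ..
  have hkd : ∀ u ∈ invDisk P, u ≠ 0 → HasDerivAt k (φ u⁻¹ - deriv φ u⁻¹ / u) u := by
    intro u hu hu0
    have hζ := (mem_invDisk_iff hu0).1 hu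
    have h1 : HasDerivAt φ (deriv φ u⁻¹) u⁻¹ := (h.hasDerivAt _ hζ).differentiableAt.hasDerivAt
    have h2 := (hasDerivAt_id u).mul (h1.comp u (hasDerivAt_inv hu0))
    refine (h2.congr_of_eventuallyEq ?_).congr_deriv ?_
    · filter_upwards [isOpen_ne.mem_nhds hu0] with v hv
      rw [hk v hv]; rfl
    · simp only [Function.comp, id]
      field_simp
      ring
  have hkc : ContinuousAt k 0 := by
    rw [continuousAt_iff_punctured_nhds, hk0]
    refine (h.asymp.comp (tendsto_inv₀_nhdsNE_zero (α := ℂ))).congr' ?_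
    filter_upwards [self_mem_nhdsWithin] with u hu
    rw [hk u hu]
    simp [mul_comm]
  have hkD : DifferentiableOn ℂ k (invDisk P) := by
    refine (Complex.differentiableOn_compl_singleton_and_continuousAt_iff
      (hopen.mem_nhds h0)).1 ⟨fun u hu => ?_, hkc⟩
    exact (hkd u hu.1 hu.2).differentiableAt.differentiableWithinAt
  have hk'D : DifferentiableOn ℂ (deriv k) (invDisk P) := hkD.deriv hopen
  set G : ℂ → ℂ := fun u => k u - u * deriv k u
  have hGd : ∀ u ∈ invDisk P, HasDerivAt G (deriv k u - (1 * deriv k u + u * deriv (deriv k) u)) u :=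
    fun u hu => ((hkD.differentiableAt (hopen.mem_nhds hu)).hasDerivAt).sub
      ((hasDerivAt_id u).mul (hk'D.differentiableAt (hopen.mem_nhds hu)).hasDerivAt)
  have hG : ∀ u ∈ invDisk P, u ≠ 0 → G u = deriv φ u⁻¹ := by
    intro u hu hu0
    simp only [G]
    rw [(hkd u hu hu0).deriv, hk u hu0]
    field_simp
    ring
  have hG0 : G 0 = 1 := by simp [G, hk0]
  have hGne : ∀ u ∈ invDisk P, G u ≠ 0 := by
    intro u hu
    rcases eq_or_ne u 0 with rfl | hu0
    · simp [hG0]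
    · rw [hG u hu hu0]
      exact h.deriv_ne_zero hn ((mem_invDisk_iff hu0).1 hu)
  have hsc : IsSimplyConnected (invDisk P) := by
    have := (convex_invDisk P).contractibleSpace ⟨0, h0⟩
    exact (inferInstance : SimplyConnectedSpace (invDisk P))
  obtain ⟨f, hfc, hf⟩ := Complex.exists_continuousOn_pow_eq hsc hopen
    (fun u hu => (hGd u hu).continuousAt.continuousWithinAt)
    (by rintro ⟨u, hu, h⟩; exact hGne u hu h) two_ne_zero
  have hf0 : f 0 ^ 2 = 1 := by rw [hf, hG0]
  have hf0' : f 0 ≠ 0 := fun h => by simp [h] at hf0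
  have hfd : ∀ u ∈ invDisk P, HasDerivAt f _ u := fun u hu =>
    hasDerivAt_of_comp_left (g := fun x => x ^ 2) (hfc.continuousAt (hopen.mem_nhds hu))
      (hasStrictDerivAt_pow 2 (f u))
      (mul_ne_zero (by norm_num) (pow_ne_zero _ fun h0 => hGne u hu (by rw [← hf, h0]; simp)))
      (hGd u hu) (Eventually.of_forall hf)
  refine ⟨fun u => f u / f 0, fun u hu => ?_, div_self hf0', ?_, fun u hu hu0 => ?_⟩
  · exact ((hfd u hu).div_const (f 0)).differentiableAt.differentiableWithinAt
  · rw [((hfd 0 h0).div_const (f 0)).deriv]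
    simp
  · rw [div_pow, hf0, div_one, hf, hG u hu hu0]

end IsExteriorMap

/-- The square root of `φ'` and its expansion in powers of `1 / ζ`. -/
theorem IsExteriorMap.exists_sqrt {P : Polynomial ℂ} {φ : ℂ → ℂ} (h : IsExteriorMap P φ)
    (hn : P.natDegree ≠ 0) :
    ∃ (s : ℂ → ℂ) (a : ℕ → ℂ), IsSqrtDeriv P φ s ∧ a 0 = 1 ∧ a 1 = 0 ∧
      ∀ ζ ∈ extDisk P, HasSum (fun k => a k * ζ⁻¹ ^ k) (s ζ) := by
  obtain ⟨g, hg, hg0, hg1, hgs⟩ := h.exists_sqrt_at_zero hn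
  have hinv : ∀ ζ ∈ extDisk P, ζ⁻¹ ∈ invDisk P := fun ζ hζ =>
    (mem_invDisk_iff (inv_ne_zero (ne_zero_of_mem_extDisk hζ))).2 (by rwa [inv_inv])
  refine ⟨fun ζ => g ζ⁻¹, fun k => (k.factorial : ℂ)⁻¹ * iteratedDeriv k g 0, ⟨?_, ?_, ?_⟩, ?_, ?_, ?_⟩
  · intro ζ hζ
    have h1 := hg.differentiableAt ((isOpen_invDisk P).mem_nhds (hinv ζ hζ))
    exact (h1.comp ζ (differentiableAt_inv (ne_zero_of_mem_extDisk hζ))).differentiableWithinAt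
  · intro ζ hζ
    rw [hgs _ (hinv ζ hζ) (inv_ne_zero (ne_zero_of_mem_extDisk hζ)), inv_inv]
  · have h1 := (hg.differentiableAt ((isOpen_invDisk P).mem_nhds (zero_mem_invDisk hn))).continuousAt
    have h2 := h1.tendsto.comp (tendsto_inv₀_cobounded (α := ℂ))
    rwa [hg0] at h2
  · simp [hg0]
  · simp [hg1]
  · intro ζ hζ
    have h1 := Complex.hasSum_taylorSeries_on_eball hg (hinv ζ hζ)
    refine h1.congr_fun fun k => ?_
    simp only [sub_zero, smul_eq_mul]
    ring

theorem IsSqrtDeriv.eqOn {P : Polynomial ℂ} {φ ψ s r : ℂ → ℂ} (hn : P.natDegree ≠ 0)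
    (hφ : IsExteriorMap P φ) (hφψ : Set.EqOn ψ φ (extDisk P))
    (hs : IsSqrtDeriv P ψ s) (hr : IsSqrtDeriv P φ r) : Set.EqOn s r (extDisk P) := by
  have hd : ∀ ζ ∈ extDisk P, deriv ψ ζ = deriv φ ζ := fun ζ hζ =>
    (Filter.eventuallyEq_of_mem ((isOpen_extDisk hn).mem_nhds hζ) hφψ).deriv_eq
  have hr0 : ∀ ζ ∈ extDisk P, r ζ ≠ 0 := fun ζ hζ h0 => hφ.deriv_ne_zero hn hζ (by
    rw [← hr.sq_eq ζ hζ, h0]; simp)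
  intro z hz
  have hconst : ∀ x ∈ extDisk P, s x / r x = s z / r z := fun x hx =>
    exists_eq_of_pow_eq_one (isPreconnected_extDisk hn) (h := fun x => s x / r x) (m := 2)
      (hs.holo.continuousOn.div hr.holo.continuousOn hr0) two_ne_zero
      (fun x hx => by
        rw [div_pow, hs.sq_eq x hx, hr.sq_eq x hx, hd x hx, div_self (hφ.deriv_ne_zero hn hx)])
      hx hz
  have hlim := hs.asymp.div hr.asymp one_ne_zero
  rw [div_one] at hlim
  have h2 : Tendsto (fun _ : ℂ => s z / r z) (Bornology.cobounded ℂ) (𝓝 1) := by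
    refine hlim.congr' ?_
    filter_upwards [eventually_mem_extDisk hn] with x hx
    exact hconst x hx
  have h3 := tendsto_nhds_unique h2 tendsto_const_nhds
  exact (div_eq_one_iff_eq (hr0 z hz)).1 h3.symm

theorem integral_exp_int_mul (m : ℤ) :
    ∫ θ in (0 : ℝ)..(2 * Real.pi), Complex.exp (m * Complex.I * θ) =
      if m = 0 then (2 * Real.pi : ℂ) else 0 := by
  split_ifs with h
  · simp [h]
  · have hm : (m : ℂ) * Complex.I ≠ 0 := mul_ne_zero (by exact_mod_cast h) Complex.I_ne_zero
    rw [integral_exp_mul_complex hm]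
    have : (m : ℂ) * Complex.I * ((2 * Real.pi : ℝ) : ℂ) = m * (2 * Real.pi * Complex.I) := by
      push_cast; ring
    rw [this, Complex.exp_int_mul_two_pi_mul_I]
    simp

/-- The Fourier coefficients of a Laurent series on a circle. -/
theorem fourierCoeffOn_of_hasSum {c : ℤ → ℂ} {r : ℝ} {f : ℝ → ℂ}
    (h : ∀ θ : ℝ, HasSum (fun k : ℤ => c k * (r * Complex.exp (θ * Complex.I)) ^ k) (f θ)) (j : ℤ) :
    fourierCoeffOn Real.two_pi_pos f j = c j * r ^ j := by
  have hsum : Summable fun k : ℤ => ‖c k * (r : ℂ) ^ k‖ := by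
    simpa using (h 0).summable.norm
  have hfour : ∀ x : ℝ, fourier (-j) (x : AddCircle (2 * Real.pi - 0)) =
      Complex.exp (-(j * Complex.I * x)) := fun x => by
    rw [fourier_coe_apply]
    congr 1
    have : (Real.pi : ℂ) ≠ 0 := by exact_mod_cast Real.pi_ne_zero
    push_cast
    rw [sub_zero]
    field_simp
  have hterm : ∀ (k : ℤ) (x : ℝ), Complex.exp (-(j * Complex.I * x)) *
      (c k * (r * Complex.exp (x * Complex.I)) ^ k) =
      c k * (r : ℂ) ^ k * Complex.exp ((k - j : ℤ) * Complex.I * x) := fun k x => by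
    rw [mul_zpow, ← Complex.exp_int_mul]
    have : Complex.exp ((k - j : ℤ) * Complex.I * x) =
        Complex.exp (-(j * Complex.I * x)) * Complex.exp (k * (x * Complex.I)) := by
      rw [← Complex.exp_add]; congr 1; push_cast; ring
    rw [this]; ring
  have hint := intervalIntegral.hasSum_integral_of_dominated_convergence (μ := volume)
    (a := 0) (b := 2 * Real.pi)
    (F := fun (k : ℤ) (x : ℝ) => c k * (r : ℂ) ^ k * Complex.exp ((k - j : ℤ) * Complex.I * x))
    (f := fun x : ℝ => Complex.exp (-(j * Complex.I * x)) * f x)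
    (fun k _ => ‖c k * (r : ℂ) ^ k‖)
    (fun k => (Continuous.aestronglyMeasurable (by fun_prop)))
    (fun k => Eventually.of_forall fun x _ => by
      rw [norm_mul]
      have : ‖Complex.exp ((k - j : ℤ) * Complex.I * x)‖ = 1 := by
        rw [Complex.norm_exp]; simp
      rw [this, mul_one])
    (Eventually.of_forall fun x _ => hsum)
    (by simp)
    (Eventually.of_forall fun x _ => by
      refine ((h x).mul_left (Complex.exp (-(j * Complex.I * x)))).congr_fun fun k => ?_
      rw [hterm])
  rw [fourierCoeffOn_eq_integral]
  simp only [hfour, smul_eq_mul, sub_zero]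
  have h2 : HasSum (fun k : ℤ => if k = j then c j * (r : ℂ) ^ j * (2 * Real.pi : ℂ) else 0)
      (∫ x in (0 : ℝ)..(2 * Real.pi), Complex.exp (-(j * Complex.I * x)) * f x) := by
    refine hint.congr_fun fun k => ?_
    rw [intervalIntegral.integral_const_mul, integral_exp_int_mul]
    by_cases hk : k = j
    · subst hk; simp
    · simp [hk, sub_eq_zero]
  have h3 := h2.unique (hasSum_ite_eq j _)
  rw [h3, Complex.real_smul]
  have : (Real.pi : ℂ) ≠ 0 := by exact_mod_cast Real.pi_ne_zero
  push_cast
  field_simp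

/-- Parseval's identity for a Laurent series on a circle. -/
theorem hasSum_sq_of_hasSum {c : ℤ → ℂ} {r : ℝ} {f : ℝ → ℂ} (hf : Continuous f)
    (h : ∀ θ : ℝ, HasSum (fun k : ℤ => c k * (r * Complex.exp (θ * Complex.I)) ^ k) (f θ)) :
    HasSum (fun k : ℤ => ‖c k * (r : ℂ) ^ k‖ ^ 2)
      ((2 * Real.pi)⁻¹ * ∫ θ in (0 : ℝ)..(2 * Real.pi), ‖f θ‖ ^ 2) := by
  have hL2 : MemLp f 2 (volume.restrict (Set.Ioc 0 (2 * Real.pi))) := by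
    obtain ⟨C, hC⟩ := isCompact_Icc.exists_bound_of_continuousOn hf.continuousOn
    exact MemLp.of_bound hf.aestronglyMeasurable C
      (ae_restrict_of_forall_mem measurableSet_Ioc fun x hx => hC x (Set.Ioc_subset_Icc_self hx))
  have := hasSum_sq_fourierCoeffOn Real.two_pi_pos hL2
  simp only [fourierCoeffOn_of_hasSum h, sub_zero, smul_eq_mul] at this
  exact this

/-- Uniqueness of Laurent coefficients at infinity. -/
theorem IsLaurentAtInfty.unique {s r : ℂ → ℂ} {c d : ℤ → ℂ} (hc : IsLaurentAtInfty s c)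
    (hd : IsLaurentAtInfty r d) (hsr : ∀ᶠ ζ in Bornology.cobounded ℂ, s ζ = r ζ) : c = d := by
  have hev := hc.and (hd.and hsr)
  rw [← comap_norm_atTop] at hev
  obtain ⟨t, ht, htsub⟩ := hev
  obtain ⟨ρ, hρ0, hρ⟩ := ((eventually_gt_atTop (0 : ℝ)).and ht).exists
  have hmem : ∀ θ : ℝ, ‖(ρ * Complex.exp (θ * Complex.I) : ℂ)‖ = ρ := fun θ => by
    rw [norm_mul, Complex.norm_exp_ofReal_mul_I, mul_one, Complex.norm_real, Real.norm_of_nonneg hρ0.le]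
  have key := fun θ : ℝ => htsub (show (ρ * Complex.exp (θ * Complex.I) : ℂ) ∈ norm ⁻¹' t by
    rw [Set.mem_preimage, hmem]; exact hρ)
  funext k
  have h1 := fourierCoeffOn_of_hasSum (f := fun θ => s (ρ * Complex.exp (θ * Complex.I)))
    (fun θ => (key θ).1) k
  have h2 := fourierCoeffOn_of_hasSum (f := fun θ => s (ρ * Complex.exp (θ * Complex.I)))
    (c := d) (fun θ => by
      have h3 := (key θ).2.1
      rwa [← (key θ).2.2] at h3) k
  rw [h1] at h2
  exact mul_right_cancel₀ (zpow_ne_zero k (by exact_mod_cast hρ0.ne')) h2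

open scoped ENNReal NNReal

theorem hausdorffMeasure_image_le_of_norm_deriv_sub_le {N s : Set ℝ} (hN : Convex ℝ N) (hs : s ⊆ N)
    (hsm : MeasurableSet s) {γ γ' : ℝ → ℂ} (hγ : ∀ x ∈ N, HasDerivAt γ (γ' x) x) {a : ℂ} {ε : ℝ≥0}
    (ha : ∀ x ∈ N, ‖γ' x - a‖ ≤ ε) :
    Measure.hausdorffMeasure (1 : ℝ) (γ '' s) ≤ (∫⁻ x in s, ‖γ' x‖ₑ) + 2 * ε * volume s ∧
    (∫⁻ x in s, ‖γ' x‖ₑ) ≤ Measure.hausdorffMeasure (1 : ℝ) (γ '' s) + 2 * ε * volume s := by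
  have key : ∀ x ∈ N, ∀ y ∈ N, ‖γ y - γ x - a * (y - x : ℝ)‖ ≤ ε * ‖y - x‖ := by
    intro x hx y hy
    have := hN.norm_image_sub_le_of_norm_hasDerivWithin_le
      (f := fun t => γ t - a * t) (f' := fun t => γ' t - a) (C := ε)
      (fun t ht => by
        have h1 : HasDerivAt (fun t : ℝ => a * (t : ℂ)) (a * 1) t :=
          (HasDerivAt.ofReal_comp (hasDerivAt_id t)).const_mul a
        rw [mul_one] at h1
        exact ((hγ t ht).sub h1).hasDerivWithinAt) ha hx hy
    refine le_trans (le_of_eq ?_) this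
    congr 1
    push_cast
    ring
  have hup : Measure.hausdorffMeasure (1 : ℝ) (γ '' s) ≤ (‖a‖₊ + ε : ℝ≥0) * volume s := by
    have hL : LipschitzOnWith (‖a‖₊ + ε) γ s := by
      refine LipschitzOnWith.of_dist_le_mul fun x hx y hy => ?_
      rw [dist_eq_norm, dist_eq_norm]
      have h1 := key y (hs hy) x (hs hx)
      have h2 := norm_le_norm_add_norm_sub' (γ x - γ y) (a * (x - y : ℝ))
      rw [norm_mul, Complex.norm_real] at h2
      push_cast
      linarith
    have := hL.hausdorffMeasure_image_le (d := 1) zero_le_one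
    rwa [ENNReal.rpow_one, hausdorffMeasure_real] at this
  have hlow : ((‖a‖₊ - ε : ℝ≥0) : ℝ≥0∞) * volume s ≤ Measure.hausdorffMeasure (1 : ℝ) (γ '' s) := by
    rcases le_or_gt ‖a‖₊ ε with h | h
    · simp [tsub_eq_zero_of_le h]
    have hpos : 0 < ‖a‖₊ - ε := tsub_pos_of_lt h
    have hdist : ∀ x ∈ N, ∀ y ∈ N, (‖a‖₊ - ε : ℝ≥0) * ‖x - y‖ ≤ ‖γ x - γ y‖ := by
      intro x hx y hy
      have h1 := key y hy x hx
      have h2 := norm_le_norm_add_norm_sub' (a * (x - y : ℝ)) (γ x - γ y)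
      rw [norm_mul, Complex.norm_real, norm_sub_rev (a * _)] at h2
      rw [NNReal.coe_sub h.le]
      simp only [coe_nnnorm]
      linarith
    have hinj : Set.InjOn γ s := fun x hx y hy hxy => by
      have h1 := hdist x (hs hx) y (hs hy)
      rw [hxy, sub_self, norm_zero] at h1
      have h2 : ‖x - y‖ = 0 := le_antisymm
        (nonpos_of_mul_nonpos_right h1 (by exact_mod_cast hpos)) (norm_nonneg _)
      exact sub_eq_zero.1 (norm_eq_zero.1 h2)
    have hL : LipschitzOnWith (‖a‖₊ - ε)⁻¹ (Function.invFunOn γ s) (γ '' s) := by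
      refine LipschitzOnWith.of_dist_le_mul ?_
      rintro _ ⟨x, hx, rfl⟩ _ ⟨y, hy, rfl⟩
      rw [hinj.leftInvOn_invFunOn hx, hinj.leftInvOn_invFunOn hy, dist_eq_norm, dist_eq_norm,
        NNReal.coe_inv, inv_mul_eq_div, le_div_iff₀ (by exact_mod_cast hpos), mul_comm]
      exact hdist x (hs hx) y (hs hy)
    have h3 := hL.hausdorffMeasure_image_le (d := 1) zero_le_one
    rw [hinj.leftInvOn_invFunOn.image_image, ENNReal.rpow_one, hausdorffMeasure_real,
      ENNReal.coe_inv hpos.ne'] at h3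
    calc ((‖a‖₊ - ε : ℝ≥0) : ℝ≥0∞) * volume s
        ≤ ((‖a‖₊ - ε : ℝ≥0) : ℝ≥0∞) * (((‖a‖₊ - ε : ℝ≥0) : ℝ≥0∞)⁻¹ *
          Measure.hausdorffMeasure (1 : ℝ) (γ '' s)) := by gcongr
      _ = _ := by
        rw [← mul_assoc, ENNReal.mul_inv_cancel (by exact_mod_cast hpos.ne') ENNReal.coe_ne_top,
          one_mul]
  have hnn : ∀ x ∈ N, ‖a‖₊ ≤ ‖γ' x‖₊ + ε ∧ ‖γ' x‖₊ ≤ ‖a‖₊ + ε := fun x hx => by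
    have h1 := ha x hx
    constructor
    · have h2 := norm_le_norm_add_norm_sub (γ' x) a
      rw [← NNReal.coe_le_coe]; push_cast; linarith
    · have h2 := norm_le_norm_add_norm_sub' (γ' x) a
      rw [← NNReal.coe_le_coe]; push_cast; linarith
  constructor
  · calc _ ≤ (‖a‖₊ + ε : ℝ≥0) * volume s := hup
      _ = ∫⁻ _ in s, (‖a‖₊ + ε : ℝ≥0) := by rw [setLIntegral_const]
      _ ≤ ∫⁻ x in s, (‖γ' x‖ₑ + 2 * ε) := by
        refine setLIntegral_mono' hsm fun x hx => ?_
        have := (hnn x (hs hx)).1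
        have h2 : ‖a‖₊ + ε ≤ ‖γ' x‖₊ + 2 * ε := by
          rw [two_mul, ← add_assoc]; gcongr
        rw [enorm_eq_nnnorm]
        exact_mod_cast h2
      _ = _ := by rw [lintegral_add_right _ measurable_const, setLIntegral_const]
  · calc _ ≤ ∫⁻ _ in s, ((‖a‖₊ - ε : ℝ≥0) + 2 * ε : ℝ≥0∞) := by
          refine setLIntegral_mono' hsm fun x hx => ?_
          have := (hnn x (hs hx)).2
          have h2 : ‖γ' x‖₊ ≤ (‖a‖₊ - ε) + 2 * ε := by
            refine this.trans ?_
            rw [two_mul, ← add_assoc]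
            gcongr
            exact le_tsub_add
          exact_mod_cast h2
      _ = ((‖a‖₊ - ε : ℝ≥0) : ℝ≥0∞) * volume s + 2 * ε * volume s := by
          rw [setLIntegral_const, add_mul]
      _ ≤ _ := by gcongr

/-- The length of the image of an injective `C¹` curve. -/
theorem hausdorffMeasure_image_eq_lintegral {A : Set ℝ} (hA : IsOpen A) (hfin : volume A ≠ ∞)
    {γ γ' : ℝ → ℂ} (hγ : ∀ x ∈ A, HasDerivAt γ (γ' x) x) (hγ' : ContinuousOn γ' A)
    (hinj : Set.InjOn γ A) :
    Measure.hausdorffMeasure (1 : ℝ) (γ '' A) = ∫⁻ x in A, ‖γ' x‖ₑ := by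
  rcases A.eq_empty_or_nonempty with rfl | hne
  · simp
  have main : ∀ ε : ℝ≥0, 0 < ε →
      Measure.hausdorffMeasure (1 : ℝ) (γ '' A) ≤ (∫⁻ x in A, ‖γ' x‖ₑ) + 2 * ε * volume A ∧
      (∫⁻ x in A, ‖γ' x‖ₑ) ≤ Measure.hausdorffMeasure (1 : ℝ) (γ '' A) + 2 * ε * volume A := by
    intro ε hε
    have hloc : ∀ x ∈ A, ∃ δ > 0, Metric.ball x δ ⊆ A ∧ ∀ y ∈ Metric.ball x δ, ‖γ' y - γ' x‖ ≤ ε := by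
      intro x hx
      have h1 : ∀ᶠ y in 𝓝 x, y ∈ A ∧ γ' y ∈ Metric.ball (γ' x) ε := by
        filter_upwards [hA.mem_nhds hx, (hγ'.continuousAt (hA.mem_nhds hx)).eventually
          (Metric.ball_mem_nhds (γ' x) (NNReal.coe_pos.2 hε))] with y h1 h2 using ⟨h1, h2⟩
      obtain ⟨δ, hδ, h⟩ := Metric.eventually_nhds_iff_ball.1 h1
      exact ⟨δ, hδ, fun y hy => (h y hy).1, fun y hy => (mem_ball_iff_norm.1 (h y hy).2).le⟩
    choose! δ hδ0 hδA hδ using hloc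
    obtain ⟨t, htA, htc, ht⟩ := TopologicalSpace.countable_cover_nhdsWithin
      (f := fun x => Metric.ball x (δ x)) (s := A)
      fun x hx => mem_nhdsWithin_of_mem_nhds (Metric.ball_mem_nhds x (hδ0 x hx))
    have htne : t.Nonempty := by
      obtain ⟨x, hx⟩ := hne
      obtain ⟨y, hy, -⟩ := Set.mem_iUnion₂.1 (ht hx)
      exact ⟨y, hy⟩
    obtain ⟨x, hx⟩ := htc.exists_eq_range htne
    have hxA : ∀ n, x n ∈ A := fun n => htA (hx ▸ Set.mem_range_self n)
    set N : ℕ → Set ℝ := fun n => Metric.ball (x n) (δ (x n))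
    have hU : ⋃ n, disjointed N n = A := by
      rw [iUnion_disjointed]
      refine Set.Subset.antisymm (Set.iUnion_subset fun n => hδA _ (hxA n)) ?_
      rw [hx, Set.biUnion_range] at ht
      exact ht
    have hmeas : ∀ n, MeasurableSet (disjointed N n) :=
      fun n => MeasurableSet.disjointed (fun n => measurableSet_ball) n
    have hsub : ∀ n, disjointed N n ⊆ N n := disjointed_subset N
    have hsubA : ∀ n, disjointed N n ⊆ A := fun n => (hsub n).trans (hδA _ (hxA n))
    have hdisj : Pairwise (Function.onFun Disjoint (disjointed N)) := disjoint_disjointed N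
    have hγc : ContinuousOn γ A := fun x hx => (hγ x hx).continuousAt.continuousWithinAt
    have hmu : Measure.hausdorffMeasure (1 : ℝ) (γ '' A) =
        ∑' n, Measure.hausdorffMeasure (1 : ℝ) (γ '' disjointed N n) := by
      conv_lhs => rw [← hU, Set.image_iUnion]
      refine measure_iUnion (fun i j hij => ?_) fun n =>
        (hmeas n).image_of_continuousOn_injOn (hγc.mono (hsubA n)) (hinj.mono (hsubA n))
      exact Set.disjoint_image_image fun a ha b hb hab =>
        Set.disjoint_left.1 (hdisj hij) ha (hinj (hsubA i ha) (hsubA j hb) hab ▸ hb)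
    have hint : ∫⁻ x in A, ‖γ' x‖ₑ = ∑' n, ∫⁻ x in disjointed N n, ‖γ' x‖ₑ := by
      conv_lhs => rw [← hU]
      exact lintegral_iUnion hmeas hdisj _
    have hvol : volume A = ∑' n, volume (disjointed N n) := by
      conv_lhs => rw [← hU]
      exact measure_iUnion hdisj hmeas
    have hpiece := fun n => hausdorffMeasure_image_le_of_norm_deriv_sub_le (N := N n)
      (convex_ball _ _) (hsub n) (hmeas n) (fun y hy => hγ y (hδA _ (hxA n) hy)) (hδ _ (hxA n))
    rw [hmu, hint, hvol, ← ENNReal.tsum_mul_left, ← ENNReal.tsum_add, ← ENNReal.tsum_add]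
    exact ⟨ENNReal.tsum_le_tsum fun n => (hpiece n).1, ENNReal.tsum_le_tsum fun n => (hpiece n).2⟩
  have small : ∀ η : ℝ≥0, 0 < η → ∃ ε : ℝ≥0, 0 < ε ∧ 2 * ε * volume A ≤ η := by
    intro η hη
    lift volume A to ℝ≥0 using hfin with V
    refine ⟨η / (2 * (V + 1)), by positivity, ?_⟩
    have : 2 * (η / (2 * (V + 1))) * V ≤ η := by
      have h1 : (2 * (η / (2 * (V + 1))) * V : ℝ≥0) = η * (V / (V + 1)) := by field_simp
      rw [h1]
      exact mul_le_of_le_one_right' (div_le_one_of_le₀ (le_add_of_nonneg_right zero_le_one) (by positivity))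
    exact_mod_cast this
  refine le_antisymm ?_ ?_ <;> refine ENNReal.le_of_forall_pos_le_add fun η hη _ => ?_ <;>
    obtain ⟨ε, hε, h⟩ := small η hη
  · exact (main ε hε).1.trans (by gcongr)
  · exact (main ε hε).2.trans (by gcongr)

/-- The critical values of `P`, together with `0`. -/
def critValues (P : Polynomial ℂ) : Set ℂ :=
  insert 0 (P.eval '' {z | P.derivative.eval z = 0})

/-- The angles `θ` such that the line `arg v = n θ` contains no nonzero critical value and
is not the real line. -/
def goodAngles (P : Polynomial ℂ) : Set ℝ :=
  {θ | ∀ v ∈ critValues P, Real.sin (P.natDegree * θ - v.arg) ≠ 0}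

theorem finite_critValues {P : Polynomial ℂ} (hn : P.natDegree ≠ 0) : (critValues P).Finite :=
  ((finite_critical hn).image _).insert 0

theorem isOpen_goodAngles {P : Polynomial ℂ} (hn : P.natDegree ≠ 0) : IsOpen (goodAngles P) := by
  have : goodAngles P = ⋂ v ∈ critValues P, {θ : ℝ | Real.sin (P.natDegree * θ - v.arg) ≠ 0} := by
    ext θ; simp [goodAngles]
  rw [this]
  exact (finite_critValues hn).isOpen_biInter fun v _ =>
    isOpen_ne_fun (by fun_prop) continuous_const

theorem countable_compl_goodAngles {P : Polynomial ℂ} (hn : P.natDegree ≠ 0) :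
    (goodAngles P)ᶜ.Countable := by
  have : (goodAngles P)ᶜ ⊆ ⋃ v ∈ critValues P,
      Set.range fun k : ℤ => (v.arg + k * Real.pi) / P.natDegree := by
    intro θ hθ
    simp only [goodAngles, Set.mem_compl_iff, Set.mem_ofPred_eq, not_forall, not_not] at hθ
    obtain ⟨v, hv, h⟩ := hθ
    obtain ⟨k, hk⟩ := Real.sin_eq_zero_iff.1 h
    refine Set.mem_biUnion hv ⟨k, ?_⟩
    have : (P.natDegree : ℝ) ≠ 0 := by exact_mod_cast hn
    simp only
    rw [hk]
    field_simp
    ring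
  exact ((finite_critValues hn).countable.biUnion fun v _ => Set.countable_range _).mono this

theorem ne_zero_of_mem_goodAngles {P : Polynomial ℂ} {θ : ℝ} (h : θ ∈ goodAngles P) : θ ≠ 0 := by
  rintro rfl
  exact h 0 (Set.mem_insert _ _) (by simp)

theorem add_mem_goodAngles {P : Polynomial ℂ} {θ a : ℝ} {k : ℤ}
    (ha : P.natDegree * a = k * (2 * Real.pi)) :
    θ + a ∈ goodAngles P ↔ θ ∈ goodAngles P := by
  simp only [goodAngles, Set.mem_ofPred_eq]
  refine forall₂_congr fun v _ => ?_
  rw [mul_add, ha, add_sub_right_comm, Real.sin_add_int_mul_two_pi]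

theorem exp_mul_abs_sin_le (n : ℕ) (w v : ℂ) :
    Real.exp (n * w.re) * |Real.sin (n * w.im - v.arg)| ≤ ‖Complex.exp (n * w) - v‖ := by
  have h1 : (Complex.exp (n * w) - v) * Complex.exp (-(v.arg * Complex.I)) =
      Complex.exp ((n * w.re : ℝ) + ((n * w.im - v.arg : ℝ) : ℂ) * Complex.I) - (‖v‖ : ℂ) := by
    have hv : v * Complex.exp (-(v.arg * Complex.I)) = ‖v‖ := by
      nth_rewrite 1 [← Complex.norm_mul_exp_arg_mul_I v]
      rw [mul_assoc, ← Complex.exp_add, add_neg_cancel, Complex.exp_zero, mul_one]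
    rw [sub_mul, hv, ← Complex.exp_add]
    congr 2
    nth_rewrite 1 [← Complex.re_add_im w]
    push_cast
    ring
  have h2 : ‖Complex.exp (n * w) - v‖ =
      ‖(Complex.exp (n * w) - v) * Complex.exp (-(v.arg * Complex.I))‖ := by
    rw [norm_mul, ← neg_mul, ← Complex.ofReal_neg, Complex.norm_exp_ofReal_mul_I, mul_one]
  rw [h2, h1]
  refine le_trans (le_of_eq ?_) (Complex.abs_im_le_norm _)
  rw [Complex.sub_im, Complex.ofReal_im, sub_zero, Complex.exp_im]
  simp [abs_mul]

theorem eval_ne_exp_of_mem_goodAngles {P : Polynomial ℂ} {w : ℂ} (hw : w.im ∈ goodAngles P) {z : ℂ}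
    (hz : P.derivative.eval z = 0) : P.eval z ≠ Complex.exp (P.natDegree * w) := by
  intro h
  have h1 := exp_mul_abs_sin_le P.natDegree w (P.eval z)
  rw [h, sub_self, norm_zero, ← h] at h1
  have h2 : |Real.sin (P.natDegree * w.im - (P.eval z).arg)| ≤ 0 :=
    nonpos_of_mul_nonpos_right h1 (Real.exp_pos _)
  exact hw _ (Set.mem_insert_of_mem _ ⟨z, hz, rfl⟩) (abs_nonpos_iff.1 h2)

/-- The half-plane `T ≤ n re w`. -/
def closedLogExtDisk (P : Polynomial ℂ) : Set ℂ :=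
  {w | maxCritValue P ≤ ((P.natDegree * w.re : ℝ) : EReal)}

theorem mem_logExtDisk_of_re_lt {P : Polynomial ℂ} (hn : P.natDegree ≠ 0) {w w' : ℂ}
    (hw : w ∈ closedLogExtDisk P) (h : w.re < w'.re) : w' ∈ logExtDisk P := by
  have h1 : maxCritValue P ≤ ((P.natDegree * w.re : ℝ) : EReal) := hw
  refine h1.trans_lt ?_
  exact_mod_cast mul_lt_mul_of_pos_left h (by exact_mod_cast Nat.pos_of_ne_zero hn)

theorem logExtDisk_subset_closed (P : Polynomial ℂ) : logExtDisk P ⊆ closedLogExtDisk P :=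
  fun w h => (show maxCritValue P < ((P.natDegree * w.re : ℝ) : EReal) from h).le

theorem mem_closed_of_re_eq {P : Polynomial ℂ} {w w' : ℂ}
    (hw : w ∈ closedLogExtDisk P) (h : w.re = w'.re) : w' ∈ closedLogExtDisk P := by
  simp only [closedLogExtDisk, Set.mem_ofPred_eq] at hw ⊢
  rwa [← h]

theorem closedLogExtDisk_subset_closure {P : Polynomial ℂ} (hn : P.natDegree ≠ 0) :
    closedLogExtDisk P ⊆ closure (logExtDisk P) := by
  intro w hw
  have h1 : Tendsto (fun ε : ℝ => w + ε) (𝓝[>] 0) (𝓝 w) := by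
    have : Tendsto (fun ε : ℝ => w + ε) (𝓝 0) (𝓝 (w + (0 : ℝ))) :=
      (by fun_prop : Continuous fun ε : ℝ => w + (ε : ℂ)).tendsto 0
    simp only [Complex.ofReal_zero, add_zero] at this
    exact this.mono_left nhdsWithin_le_nhds
  refine mem_closure_of_tendsto h1 ?_
  filter_upwards [self_mem_nhdsWithin] with ε hε
  exact mem_logExtDisk_of_re_lt hn hw (by simpa using hε)

namespace IsExpParam

variable {P : Polynomial ℂ} {Φ : ℂ → ℂ}

theorem exists_lift_near (h : IsExpParam P Φ) (hn : P.natDegree ≠ 0) {w : ℂ}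
    (hw : w ∈ closedLogExtDisk P) (hg : w.im ∈ goodAngles P) :
    ∃ (C : Set ℂ) (Ψ : ℂ → ℂ), IsOpen C ∧ Convex ℝ C ∧ w ∈ C ∧
      (∀ x ∈ C, ∀ r : ℝ, x + r ∈ C) ∧ (∀ x ∈ C, x.im ∈ goodAngles P) ∧ ContinuousOn Ψ C ∧
      (∀ x ∈ C, P.eval (Ψ x) = Complex.exp (P.natDegree * x)) ∧
      Set.EqOn (extendFrom (logExtDisk P) Φ) Ψ (C ∩ closedLogExtDisk P) := by
  obtain ⟨δ, hδ, hball⟩ := Metric.isOpen_iff.1 (isOpen_goodAngles hn) _ hg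
  set C : Set ℂ := Complex.im ⁻¹' Metric.ball w.im δ
  have hCo : IsOpen C := Metric.isOpen_ball.preimage Complex.continuous_im
  have hCc : Convex ℝ C := (convex_ball _ _).linear_preimage Complex.imLm
  have hwC : w ∈ C := Metric.mem_ball_self hδ
  have hCadd : ∀ x ∈ C, ∀ r : ℝ, x + r ∈ C := fun x hx r => by
    simp only [C, Set.mem_preimage, Complex.add_im, Complex.ofReal_im, add_zero]
    exact hx
  have hgood : ∀ x ∈ C, x.im ∈ goodAngles P := fun x hx => hball hx
  have hw1 : w + (1 : ℝ) ∈ logExtDisk P := mem_logExtDisk_of_re_lt hn hw (by simp)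
  obtain ⟨Ψ, hΨc, hΨ, hΨ1⟩ := exists_lift P P.natDegree hCo hCc
    (fun x hx z hz => eval_ne_exp_of_mem_goodAngles (hgood x hx) hz) (hCadd w hwC 1)
    (h.eval_eq _ hw1)
  have hEq : Set.EqOn Φ Ψ (C ∩ logExtDisk P) :=
    lift_unique (n := P.natDegree) (hCo.inter (isOpen_logExtDisk P))
      (hCc.inter (convex_logExtDisk P)).isPreconnected
      (fun x hx z hz => eval_ne_exp_of_mem_goodAngles (hgood x hx.1) hz)
      (h.cont.mono Set.inter_subset_right) (fun x hx => h.eval_eq x hx.2)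
      (hΨc.mono Set.inter_subset_left) (fun x hx => hΨ x hx.1) ⟨hCadd w hwC 1, hw1⟩ hΨ1.symm
  refine ⟨C, Ψ, hCo, hCc, hwC, hCadd, hgood, hΨc, hΨ, fun x hx => ?_⟩
  refine extendFrom_eq (closedLogExtDisk_subset_closure hn hx.2) ?_
  have h1 : Tendsto Ψ (𝓝[logExtDisk P] x) (𝓝 (Ψ x)) :=
    (hΨc.continuousAt (hCo.mem_nhds hx.1)).tendsto.mono_left nhdsWithin_le_nhds
  refine h1.congr' ?_
  filter_upwards [self_mem_nhdsWithin, mem_nhdsWithin_of_mem_nhds (hCo.mem_nhds hx.1)] with y h1 h2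
  exact (hEq ⟨h2, h1⟩).symm

theorem extend_eq (h : IsExpParam P Φ) {w : ℂ} (hw : w ∈ logExtDisk P) :
    extendFrom (logExtDisk P) Φ w = Φ w :=
  extendFrom_eq (subset_closure hw) (h.cont w hw)

theorem extend_eval_eq (h : IsExpParam P Φ) (hn : P.natDegree ≠ 0) {w : ℂ}
    (hw : w ∈ closedLogExtDisk P) (hg : w.im ∈ goodAngles P) :
    P.eval (extendFrom (logExtDisk P) Φ w) = Complex.exp (P.natDegree * w) := by
  obtain ⟨C, Ψ, -, -, hwC, -, -, -, hΨ, hEq⟩ := h.exists_lift_near hn hw hg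
  rw [hEq ⟨hwC, hw⟩, hΨ w hwC]

theorem extend_deriv_ne (h : IsExpParam P Φ) (hn : P.natDegree ≠ 0) {w : ℂ}
    (hw : w ∈ closedLogExtDisk P) (hg : w.im ∈ goodAngles P) :
    P.derivative.eval (extendFrom (logExtDisk P) Φ w) ≠ 0 := fun h0 =>
  eval_ne_exp_of_mem_goodAngles hg h0 (h.extend_eval_eq hn hw hg)

theorem extend_continuousWithinAt (h : IsExpParam P Φ) (hn : P.natDegree ≠ 0) {w : ℂ}
    (hw : w ∈ closedLogExtDisk P) (hg : w.im ∈ goodAngles P) :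
    ContinuousWithinAt (extendFrom (logExtDisk P) Φ) (closedLogExtDisk P) w := by
  obtain ⟨C, Ψ, hCo, -, hwC, -, -, hΨc, -, hEq⟩ := h.exists_lift_near hn hw hg
  have h1 := (hΨc.continuousAt (hCo.mem_nhds hwC)).continuousWithinAt (s := closedLogExtDisk P)
  refine h1.congr_of_eventuallyEq ?_ (hEq ⟨hwC, hw⟩)
  filter_upwards [self_mem_nhdsWithin, mem_nhdsWithin_of_mem_nhds (hCo.mem_nhds hwC)] with y h1 h2
  exact hEq ⟨h2, h1⟩

theorem extend_hasDerivAt (h : IsExpParam P Φ) (hn : P.natDegree ≠ 0) {σ θ : ℝ}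
    (hw : (σ + θ * Complex.I : ℂ) ∈ closedLogExtDisk P) (hg : θ ∈ goodAngles P) :
    HasDerivAt (fun x : ℝ => extendFrom (logExtDisk P) Φ (σ + x * Complex.I))
      (P.natDegree * Complex.exp (P.natDegree * (σ + θ * Complex.I)) /
        P.derivative.eval (extendFrom (logExtDisk P) Φ (σ + θ * Complex.I)) * Complex.I) θ := by
  obtain ⟨C, Ψ, hCo, -, hwC, -, hgood, hΨc, hΨ, hEq⟩ := h.exists_lift_near hn hw (by simpa using hg)
  have h1 := (hasDerivAt_lift hCo (fun x hx z hz => eval_ne_exp_of_mem_goodAngles (hgood x hx) hz)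
    hΨc hΨ hwC).2
  have h2 : HasDerivAt (fun x : ℝ => (σ + x * Complex.I : ℂ)) Complex.I θ := by
    have := ((HasDerivAt.ofReal_comp (hasDerivAt_id θ)).mul_const Complex.I).const_add (σ : ℂ)
    simpa using this
  have h3 := h1.comp θ h2
  rw [hEq ⟨hwC, hw⟩]
  refine h3.congr_of_eventuallyEq ?_
  have hcont : Continuous fun x : ℝ => (σ + x * Complex.I : ℂ) := by fun_prop
  filter_upwards [hcont.continuousAt.preimage_mem_nhds (hCo.mem_nhds hwC)] with x hx
  exact hEq ⟨hx, mem_closed_of_re_eq hw (by simp)⟩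

theorem extend_exp_eq_exp (h : IsExpParam P Φ) (hn : P.natDegree ≠ 0) {w w' : ℂ}
    (hw : w ∈ closedLogExtDisk P) (hg : w.im ∈ goodAngles P)
    (hw' : w' ∈ closedLogExtDisk P) (hg' : w'.im ∈ goodAngles P)
    (heq : extendFrom (logExtDisk P) Φ w = extendFrom (logExtDisk P) Φ w') :
    Complex.exp w = Complex.exp w' := by
  have hexp : Complex.exp (P.natDegree * (w' - w)) = 1 := by
    rw [mul_sub, Complex.exp_sub, ← h.extend_eval_eq hn hw hg, ← h.extend_eval_eq hn hw' hg', heq,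
      div_self]
    rw [h.extend_eval_eq hn hw' hg']; exact Complex.exp_ne_zero _
  have hre := exp_mul_eq_one_re hn hexp
  obtain ⟨C, Ψ, hCo, hCc, hwC, hCadd, hgood, hΨc, hΨ, hEq⟩ := h.exists_lift_near hn hw hg
  obtain ⟨C', Ψ', hCo', hCc', hwC', hCadd', hgood', hΨc', hΨ', hEq'⟩ :=
    h.exists_lift_near hn hw' hg'
  set D : Set ℂ := C ∩ (fun x => x + (w' - w)) ⁻¹' C'
  have hDo : IsOpen D := hCo.inter (hCo'.preimage (by fun_prop))
  have hDc : Convex ℝ D := hCc.inter (hCc'.translate_preimage_left _)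
  have hwD : w ∈ D := ⟨hwC, by simpa using hwC'⟩
  have hEqD : Set.EqOn Ψ (fun x => Ψ' (x + (w' - w))) D := by
    refine lift_unique (n := P.natDegree) hDo hDc.isPreconnected
      (fun x hx z hz => eval_ne_exp_of_mem_goodAngles (hgood x hx.1) hz)
      (hΨc.mono Set.inter_subset_left) (fun x hx => hΨ x hx.1)
      (hΨc'.comp (by fun_prop) fun x hx => hx.2) (fun x hx => ?_) hwD ?_
    · rw [hΨ' _ hx.2, mul_add, Complex.exp_add, hexp, mul_one]
    · simp only [add_sub_cancel]
      rw [← hEq ⟨hwC, hw⟩, ← hEq' ⟨hwC', hw'⟩, heq]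
  have hwD1 : w + (1 : ℝ) ∈ D := by
    refine ⟨hCadd w hwC 1, ?_⟩
    have := hCadd' w' hwC' 1
    simp only [Set.mem_preimage]
    convert this using 1
    ring
  have h1 := hEqD hwD1
  have hin : w + (1 : ℝ) ∈ logExtDisk P := mem_logExtDisk_of_re_lt hn hw (by simp)
  have hin' : w' + (1 : ℝ) ∈ logExtDisk P := mem_logExtDisk_of_re_lt hn hw' (by simp)
  have e : w + (1 : ℝ) + (w' - w) = w' + (1 : ℝ) := by ring
  simp only at h1
  rw [e, ← hEq ⟨hCadd w hwC 1, logExtDisk_subset_closed P hin⟩,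
    ← hEq' ⟨hCadd' w' hwC' 1, logExtDisk_subset_closed P hin'⟩, h.extend_eq hin,
    h.extend_eq hin'] at h1
  have h2 := h.exp_eq_exp_of_eq hn hin hin' h1
  rw [Complex.exp_add, Complex.exp_add] at h2
  exact mul_right_cancel₀ (Complex.exp_ne_zero _) h2

theorem extend_eq_of_exp_eq (h : IsExpParam P Φ) (hn : P.natDegree ≠ 0) {w w' : ℂ}
    (hw : w ∈ closedLogExtDisk P) (hg : w.im ∈ goodAngles P)
    (hw' : w' ∈ closedLogExtDisk P) (hg' : w'.im ∈ goodAngles P)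
    (heq : Complex.exp w = Complex.exp w') :
    extendFrom (logExtDisk P) Φ w = extendFrom (logExtDisk P) Φ w' := by
  have key : ∀ x ∈ closedLogExtDisk P, x.im ∈ goodAngles P →
      Tendsto (fun ε : ℝ => Φ (x + ε)) (𝓝[>] 0) (𝓝 (extendFrom (logExtDisk P) Φ x)) := by
    intro x hx hxg
    have h1 : Tendsto (fun ε : ℝ => x + ε) (𝓝[>] 0) (𝓝[closedLogExtDisk P] x) := by
      refine tendsto_nhdsWithin_iff.2 ⟨?_, ?_⟩
      · have : Tendsto (fun ε : ℝ => x + ε) (𝓝 0) (𝓝 (x + (0 : ℝ))) :=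
          (by fun_prop : Continuous fun ε : ℝ => x + (ε : ℂ)).tendsto 0
        simp only [Complex.ofReal_zero, add_zero] at this
        exact this.mono_left nhdsWithin_le_nhds
      · filter_upwards [self_mem_nhdsWithin] with ε hε
        exact logExtDisk_subset_closed P (mem_logExtDisk_of_re_lt hn hx (by simpa using hε))
    refine ((h.extend_continuousWithinAt hn hx hxg).tendsto.comp h1).congr' ?_
    filter_upwards [self_mem_nhdsWithin] with ε hε
    exact h.extend_eq (mem_logExtDisk_of_re_lt hn hx (by simpa using hε))
  refine tendsto_nhds_unique (key w hw hg) ((key w' hw' hg').congr' ?_)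
  filter_upwards [self_mem_nhdsWithin] with ε hε
  refine ((h.eq_iff hn (mem_logExtDisk_of_re_lt hn hw (by simpa using hε))
    (mem_logExtDisk_of_re_lt hn hw' (by simpa using hε))).2 ?_).symm
  rw [Complex.exp_add, Complex.exp_add, heq]

theorem exists_extend_rotate_eq (h : IsExpParam P Φ) (hn : P.natDegree ≠ 0) {w z : ℂ}
    (hw : w ∈ closedLogExtDisk P) (hg : w.im ∈ goodAngles P)
    (hz : P.eval z = Complex.exp (P.natDegree * w)) :
    ∃ w' ∈ closedLogExtDisk P, w'.im ∈ goodAngles P ∧ w'.re = w.re ∧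
      extendFrom (logExtDisk P) Φ w' = z := by
  have hre : ∀ k : ℕ, (w + 2 * Real.pi * Complex.I * (k / P.natDegree)).re = w.re := fun k => by
    rw [Complex.add_re, rotate_re hn, add_zero]
  have hmem : ∀ k : ℕ, w + 2 * Real.pi * Complex.I * (k / P.natDegree) ∈ closedLogExtDisk P :=
    fun k => mem_closed_of_re_eq hw (hre k).symm
  have hgood : ∀ k : ℕ, (w + 2 * Real.pi * Complex.I * (k / P.natDegree)).im ∈ goodAngles P := by
    intro k
    have e : (w + 2 * Real.pi * Complex.I * (k / P.natDegree)).im =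
        w.im + 2 * Real.pi * (k / P.natDegree) := by
      have : (2 * Real.pi * Complex.I * (k / P.natDegree) : ℂ) =
        ((2 * Real.pi * (k / P.natDegree) : ℝ) : ℂ) * Complex.I := by push_cast; ring
      rw [this]; simp
    rw [e]
    refine (add_mem_goodAngles (k := k) ?_).2 hg
    have : (P.natDegree : ℝ) ≠ 0 := by exact_mod_cast hn
    push_cast
    field_simp
  obtain ⟨k, -, hk⟩ := exists_rotate_of_injOn hn
    (f := fun k => extendFrom (logExtDisk P) Φ (w + 2 * Real.pi * Complex.I * (k / P.natDegree)))
    (fun k _ => by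
      rw [h.extend_eval_eq hn (hmem k) (hgood k), mul_add, Complex.exp_add, exp_mul_rotate hn,
        mul_one])
    (fun k hk l hl hkl => by
      have := h.extend_exp_eq_exp hn (hmem k) (hgood k) (hmem l) (hgood l) hkl
      rw [Complex.exp_add, Complex.exp_add] at this
      exact exp_rotate_inj hn hk hl (mul_left_cancel₀ (Complex.exp_ne_zero _) this)) hz
  exact ⟨_, hmem k, hgood k, hre k, hk⟩

end IsExpParam

theorem intervalIntegrable_abs_sin_rpow {β : ℝ} (hβ0 : 0 ≤ β) (hβ : β < 1) (a b : ℝ) :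
    IntervalIntegrable (fun x => |Real.sin x| ^ (-β)) volume a b := by
  have hper : Function.Periodic (fun x => |Real.sin x| ^ (-β)) Real.pi := fun x => by
    simp [Real.sin_add_pi]
  refine hper.intervalIntegrable (t := -(Real.pi / 2)) Real.pi_ne_zero ?_ a b
  have hbound : IntervalIntegrable (fun x : ℝ => (2 / Real.pi * |x|) ^ (-β)) volume
      (-(Real.pi / 2)) (-(Real.pi / 2) + Real.pi) := by
    refine intervalIntegrable_of_even (fun x => by simp) (fun x hx => ?_) enorm_ne_top enorm_ne_top
    have h1 : IntervalIntegrable (fun x : ℝ => (2 / Real.pi) ^ (-β) * x ^ (-β)) volume 0 x :=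
      (intervalIntegral.intervalIntegrable_rpow' (by linarith)).const_mul _
    refine h1.congr ?_
    intro y hy
    rw [Set.uIoc_of_le hx.le] at hy
    simp only
    rw [abs_of_pos hy.1, Real.mul_rpow (by positivity) hy.1.le]
  refine hbound.mono_fun' ?_ ?_
  · exact (Measurable.pow_const (by fun_prop) _).aestronglyMeasurable
  · refine ae_restrict_of_forall_mem measurableSet_uIoc fun x hx => ?_
    rw [Set.uIoc_of_le (by linarith [Real.pi_pos])] at hx
    have hx' : |x| ≤ Real.pi / 2 := abs_le.2 ⟨hx.1.le, by linarith [hx.2]⟩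
    simp only
    rw [Real.norm_of_nonneg (by positivity)]
    rcases eq_or_ne x 0 with rfl | h0
    · simp
    · exact Real.rpow_le_rpow_of_nonpos (by have := abs_pos.2 h0; positivity)
        (Real.mul_abs_le_abs_sin hx') (by linarith)

theorem intervalIntegrable_abs_sin_mul_sub_rpow {β : ℝ} (hβ0 : 0 ≤ β) (hβ : β < 1) {n : ℕ}
    (hn : n ≠ 0) (c a b : ℝ) :
    IntervalIntegrable (fun x => |Real.sin (n * x - c)| ^ (-β)) volume a b := by
  have h1 := (intervalIntegrable_abs_sin_rpow hβ0 hβ (n * a - c) (n * b - c)).comp_sub_right c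
  have h2 := h1.comp_mul_left (c := n)
  have hn' : (n : ℝ) ≠ 0 := by exact_mod_cast hn
  simp only [sub_add_cancel] at h2
  rwa [mul_div_cancel_left₀ _ hn', mul_div_cancel_left₀ _ hn'] at h2

theorem exists_pow_le_of_isCompact {P : Polynomial ℂ} (hn : P.natDegree ≠ 0) {K : Set ℂ}
    (hK : IsCompact K) : ∃ C : ℝ, 0 < C ∧ ∀ z ∈ K, ∃ v ∈ critValues P,
      ‖P.eval z - v‖ ^ (P.natDegree - 1) ≤ C * ‖P.derivative.eval z‖ ^ P.natDegree := by
  have hd0 : P.derivative ≠ 0 := fun h => hn (Polynomial.derivative_eq_zero.1 h)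
  refine hK.induction_on (p := fun K => ∃ C : ℝ, 0 < C ∧ ∀ z ∈ K, ∃ v ∈ critValues P,
      ‖P.eval z - v‖ ^ (P.natDegree - 1) ≤ C * ‖P.derivative.eval z‖ ^ P.natDegree)
    ⟨1, one_pos, by simp⟩ ?_ ?_ ?_
  · rintro s t hst ⟨C, hC, h⟩
    exact ⟨C, hC, fun z hz => h z (hst hz)⟩
  · rintro s t ⟨C, hC, h⟩ ⟨C', hC', h'⟩
    refine ⟨max C C', lt_max_of_lt_left hC, fun z hz => ?_⟩
    rcases hz with hz | hz
    · obtain ⟨v, hv, hle⟩ := h z hz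
      exact ⟨v, hv, hle.trans (by gcongr; exact le_max_left _ _)⟩
    · obtain ⟨v, hv, hle⟩ := h' z hz
      exact ⟨v, hv, hle.trans (by gcongr; exact le_max_right _ _)⟩
  · intro z₀ _
    by_cases hz₀ : P.derivative.eval z₀ = 0
    · set v := P.eval z₀
      set Q := P - Polynomial.C v
      have hQd : Q.derivative = P.derivative := by simp [Q]
      have hQdeg : Q.natDegree = P.natDegree := Polynomial.natDegree_sub_C
      have hQ0 : Q ≠ 0 := fun h => hn (by rw [← hQdeg, h, Polynomial.natDegree_zero])
      have hroot : Q.IsRoot z₀ := by simp [Q, v]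
      set m := Q.rootMultiplicity z₀
      have hm : P.derivative.rootMultiplicity z₀ = m - 1 := by
        rw [← hQd, Polynomial.derivative_rootMultiplicity_of_root hroot]
      have hm1 : 1 ≤ m := (Polynomial.rootMultiplicity_pos hQ0).2 hroot
      have hmn : m ≤ P.natDegree := by
        rw [← hQdeg]
        exact (Polynomial.count_roots Q ▸ Multiset.count_le_card _ _).trans (Polynomial.card_roots' Q)
      obtain ⟨R, hR⟩ := Q.pow_rootMultiplicity_dvd z₀
      obtain ⟨S, hS, hSnd⟩ := Polynomial.exists_eq_pow_rootMultiplicity_mul_and_not_dvd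
        P.derivative hd0 z₀
      have hS0 : S.eval z₀ ≠ 0 := fun h => hSnd (Polynomial.dvd_iff_isRoot.2 h)
      have hev : ∀ᶠ z in 𝓝 z₀, ‖z - z₀‖ ≤ 1 ∧
          ‖R.eval z‖ ^ (P.natDegree - 1) < ‖R.eval z₀‖ ^ (P.natDegree - 1) + 1 ∧
          ‖S.eval z₀‖ ^ P.natDegree / 2 < ‖S.eval z‖ ^ P.natDegree := by
        refine ((by fun_prop : Continuous fun z => ‖z - z₀‖).tendsto z₀).eventually_le_const (by simp) |>.and
          ((((R.continuous.norm.pow _).tendsto z₀).eventually_lt_const (lt_add_one _)).and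
          (((S.continuous.norm.pow _).tendsto z₀).eventually_const_lt ?_))
        have : 0 < ‖S.eval z₀‖ ^ P.natDegree := by have := norm_pos_iff.2 hS0; positivity
        simp only [Pi.pow_apply]
        linarith
      have hSpos : 0 < ‖S.eval z₀‖ ^ P.natDegree := by have := norm_pos_iff.2 hS0; positivity
      refine ⟨_, mem_nhdsWithin_of_mem_nhds hev,
        (‖R.eval z₀‖ ^ (P.natDegree - 1) + 1) * (2 / ‖S.eval z₀‖ ^ P.natDegree), by positivity,
        fun z hz => ⟨v, Set.mem_insert_of_mem _ ⟨z₀, hz₀, rfl⟩, ?_⟩⟩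
      obtain ⟨h1, h2, h3⟩ := hz
      have e1 : ‖P.eval z - v‖ = ‖z - z₀‖ ^ m * ‖R.eval z‖ := by
        have : P.eval z - v = Q.eval z := by simp [Q]
        rw [this, hR]; simp [m]
      have e2 : ‖P.derivative.eval z‖ = ‖z - z₀‖ ^ (m - 1) * ‖S.eval z‖ := by
        conv_lhs => rw [hS, hm]
        simp
      rw [e1, e2, mul_pow, mul_pow, ← pow_mul, ← pow_mul]
      have h4 : ‖z - z₀‖ ^ (m * (P.natDegree - 1)) ≤ ‖z - z₀‖ ^ ((m - 1) * P.natDegree) := by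
        refine pow_le_pow_of_le_one (norm_nonneg _) h1 ?_
        rw [Nat.sub_mul, Nat.mul_sub, one_mul, mul_one]
        omega
      calc _ ≤ ‖z - z₀‖ ^ ((m - 1) * P.natDegree) * (‖R.eval z₀‖ ^ (P.natDegree - 1) + 1) := by
            gcongr
        _ ≤ ‖z - z₀‖ ^ ((m - 1) * P.natDegree) * ((‖R.eval z₀‖ ^ (P.natDegree - 1) + 1) *
            (2 / ‖S.eval z₀‖ ^ P.natDegree * ‖S.eval z‖ ^ P.natDegree)) := by
            gcongr
            refine le_mul_of_one_le_right (by positivity) ?_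
            rw [div_mul_eq_mul_div, le_div_iff₀ hSpos]
            linarith
        _ = _ := by ring
    · have hpos : 0 < ‖P.derivative.eval z₀‖ ^ P.natDegree := by
        have := norm_pos_iff.2 hz₀; positivity
      have hev : ∀ᶠ z in 𝓝 z₀,
          ‖P.eval z‖ ^ (P.natDegree - 1) < ‖P.eval z₀‖ ^ (P.natDegree - 1) + 1 ∧
          ‖P.derivative.eval z₀‖ ^ P.natDegree / 2 < ‖P.derivative.eval z‖ ^ P.natDegree :=
        (((P.continuous.norm.pow _).tendsto z₀).eventually_lt_const (lt_add_one _)).and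
          (((P.derivative.continuous.norm.pow _).tendsto z₀).eventually_const_lt
            (by simpa using hpos))
      refine ⟨_, mem_nhdsWithin_of_mem_nhds hev,
        (‖P.eval z₀‖ ^ (P.natDegree - 1) + 1) * (2 / ‖P.derivative.eval z₀‖ ^ P.natDegree),
        by positivity, fun z hz => ⟨0, Set.mem_insert _ _, ?_⟩⟩
      obtain ⟨h2, h3⟩ := hz
      rw [sub_zero, mul_assoc]
      refine h2.le.trans (le_mul_of_one_le_right (by positivity) ?_)
      rw [div_mul_eq_mul_div, le_div_iff₀ hpos]
      linarith

theorem isCompact_norm_eval_le {P : Polynomial ℂ} (hn : P.natDegree ≠ 0) (M : ℝ) :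
    IsCompact {z | ‖P.eval z‖ ≤ M} := by
  refine Metric.isCompact_of_isClosed_isBounded (isClosed_le (by fun_prop) continuous_const) ?_
  have hdeg : 0 < P.degree := Polynomial.natDegree_pos_iff_degree_pos.1 (Nat.pos_of_ne_zero hn)
  have := P.tendsto_norm_atTop hdeg (tendsto_norm_cobounded_atTop (E := ℂ))
  rw [← Bornology.isCobounded_compl_iff, Bornology.isCobounded_def]
  filter_upwards [this.eventually_gt_atTop M] with z hz using not_le.2 hz

/-- The speed at the angle `θ` of the parametrization of `E_P(t)` by the extension of `Φ`. -/
noncomputable def lengthDensity (P : Polynomial ℂ) (Φ : ℂ → ℂ) (t θ : ℝ) : ℝ :=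
  P.natDegree * Real.exp t /
    ‖P.derivative.eval (extendFrom (logExtDisk P) Φ ((t / P.natDegree : ℝ) + θ * Complex.I))‖

/-- The good angles in a period. -/
def anglePeriod (P : Polynomial ℂ) : Set ℝ := Set.Ioo 0 (2 * Real.pi) ∩ goodAngles P

theorem isOpen_anglePeriod {P : Polynomial ℂ} (hn : P.natDegree ≠ 0) : IsOpen (anglePeriod P) :=
  isOpen_Ioo.inter (isOpen_goodAngles hn)

theorem anglePeriod_ae_eq {P : Polynomial ℂ} (hn : P.natDegree ≠ 0) :
    anglePeriod P =ᵐ[volume] Set.Ioo 0 (2 * Real.pi) := by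
  refine inter_ae_eq_left_of_ae_eq_univ ?_
  rw [ae_eq_univ]
  exact (countable_compl_goodAngles hn).measure_zero _

theorem mem_closedLogExtDisk {P : Polynomial ℂ} (hn : P.natDegree ≠ 0) {t : ℝ}
    (ht : maxCritValue P ≤ t) (θ : ℝ) :
    ((t / P.natDegree : ℝ) + θ * Complex.I : ℂ) ∈ closedLogExtDisk P := by
  have hn' : (P.natDegree : ℝ) ≠ 0 := by exact_mod_cast hn
  simp only [closedLogExtDisk, Set.mem_ofPred_eq, Complex.add_re, Complex.ofReal_re,
    Complex.re_ofReal_mul, Complex.I_re, mul_zero, add_zero]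
  rwa [mul_div_cancel₀ _ hn']

theorem norm_exp_line {n : ℕ} (hn : n ≠ 0) (t θ : ℝ) :
    ‖Complex.exp (n * ((t / n : ℝ) + θ * Complex.I))‖ = Real.exp t := by
  have hn' : (n : ℝ) ≠ 0 := by exact_mod_cast hn
  rw [norm_exp_natCast_mul]
  simp only [Complex.add_re, Complex.ofReal_re, Complex.re_ofReal_mul, Complex.I_re, mul_zero,
    add_zero]
  rw [mul_div_cancel₀ _ hn']

namespace IsExpParam

variable {P : Polynomial ℂ} {Φ : ℂ → ℂ}

theorem levelSet_diff_countable (h : IsExpParam P Φ) (hn : P.natDegree ≠ 0) {t : ℝ}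
    (ht : maxCritValue P ≤ t) :
    (levelSet P t \ (fun θ : ℝ => extendFrom (logExtDisk P) Φ ((t / P.natDegree : ℝ) +
      θ * Complex.I)) '' anglePeriod P).Countable := by
  have hn' : (P.natDegree : ℝ) ≠ 0 := by exact_mod_cast hn
  refine Set.Countable.mono (s₂ := ⋃ θ ∈ (goodAngles P)ᶜ,
    {z | P.eval z = Complex.exp (P.natDegree * ((t / P.natDegree : ℝ) + θ * Complex.I))}) ?_
    ((countable_compl_goodAngles hn).biUnion fun θ _ => ?_)
  · rintro z ⟨hz, hnot⟩
    rw [mem_levelSet] at hz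
    have hz0 : P.eval z ≠ 0 := norm_pos_iff.1 (hz ▸ Real.exp_pos t)
    obtain ⟨w, hw⟩ := exists_eval_eq_exp hn hz0
    have hre : w.re = t / P.natDegree := by
      rw [hw, norm_exp_natCast_mul, Real.exp_eq_exp] at hz
      rw [← hz, mul_div_cancel_left₀ _ hn']
    have hform : ∀ x : ℂ, x.re = t / P.natDegree →
        ((t / P.natDegree : ℝ) + x.im * Complex.I : ℂ) = x := fun x hx => by
      rw [← hx, Complex.re_add_im]
    by_cases hg : w.im ∈ goodAngles P
    · exfalso
      have hwc : w ∈ closedLogExtDisk P := by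
        rw [← hform w hre]; exact mem_closedLogExtDisk hn ht _
      obtain ⟨w', hw', hg', hre', hz'⟩ := h.exists_extend_rotate_eq hn hwc hg hw
      set m : ℤ := ⌊w'.im / (2 * Real.pi)⌋
      have hpi := Real.two_pi_pos
      set θ : ℝ := w'.im + -(m : ℝ) * (2 * Real.pi)
      have hθg : θ ∈ goodAngles P := (add_mem_goodAngles (k := -(P.natDegree * m)) (by
        push_cast; ring)).2 hg'
      have hθ0 : 0 ≤ θ := by
        have := Int.floor_le (w'.im / (2 * Real.pi))
        rw [le_div_iff₀ hpi] at this
        simp only [θ, m]; linarith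
      have hθ1 : θ < 2 * Real.pi := by
        have := Int.lt_floor_add_one (w'.im / (2 * Real.pi))
        rw [div_lt_iff₀ hpi] at this
        simp only [θ, m]; linarith
      refine hnot ⟨θ, ⟨⟨lt_of_le_of_ne hθ0 (ne_zero_of_mem_goodAngles hθg).symm, hθ1⟩, hθg⟩, ?_⟩
      rw [← hz']
      refine h.extend_eq_of_exp_eq hn (mem_closedLogExtDisk hn ht _) (by simpa using hθg) hw' hg' ?_
      rw [Complex.exp_eq_exp_iff_exists_int]
      refine ⟨-m, ?_⟩
      conv_rhs => rw [← hform w' (hre'.trans hre)]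
      simp only [θ]
      push_cast
      ring
    · refine Set.mem_biUnion (x := w.im) hg ?_
      simp only [Set.mem_ofPred_eq]
      rw [hform w hre, hw]
  · have hne : P - Polynomial.C
        (Complex.exp (P.natDegree * ((t / P.natDegree : ℝ) + θ * Complex.I))) ≠ 0 := by
      intro h0
      have h1 := Polynomial.natDegree_sub_C (p := P)
        (a := Complex.exp (P.natDegree * ((t / P.natDegree : ℝ) + θ * Complex.I)))
      rw [h0, Polynomial.natDegree_zero] at h1
      exact hn h1.symm
    refine ((Multiset.finite_toSet (P - Polynomial.C (Complex.exp (P.natDegree *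
      ((t / P.natDegree : ℝ) + θ * Complex.I)))).roots).subset fun z hz => ?_).countable
    refine (Polynomial.mem_roots hne).2 ?_
    rw [Polynomial.IsRoot, Polynomial.eval_sub, Polynomial.eval_C, sub_eq_zero]
    exact hz

/-- The length of a level set at or above the largest critical value. -/
theorem length_eq_lintegral (h : IsExpParam P Φ) (hn : P.natDegree ≠ 0) {t : ℝ}
    (ht : maxCritValue P ≤ t) :
    length (levelSet P t) = ∫⁻ θ in anglePeriod P, ENNReal.ofReal (lengthDensity P Φ t θ) := by
  set γ : ℝ → ℂ := fun θ => extendFrom (logExtDisk P) Φ ((t / P.natDegree : ℝ) + θ * Complex.I)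
  have hmem := mem_closedLogExtDisk hn ht
  have him : ∀ θ : ℝ, ((t / P.natDegree : ℝ) + θ * Complex.I : ℂ).im = θ := fun θ => by simp
  have himage : γ '' anglePeriod P ⊆ levelSet P t := by
    rintro _ ⟨θ, hθ, rfl⟩
    rw [mem_levelSet, h.extend_eval_eq hn (hmem θ) (by rw [him]; exact hθ.2), norm_exp_line hn]
  have := Measure.nullSingletonClass_hausdorff ℂ one_pos
  have hlen : length (levelSet P t) = Measure.hausdorffMeasure (1 : ℝ) (γ '' anglePeriod P) := by
    refine le_antisymm ?_ (measure_mono himage)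
    have h0 := (h.levelSet_diff_countable hn ht).measure_zero (Measure.hausdorffMeasure (1 : ℝ))
    calc length (levelSet P t)
        ≤ Measure.hausdorffMeasure (1 : ℝ) (γ '' anglePeriod P ∪ levelSet P t \ γ '' anglePeriod P) :=
          measure_mono (by rw [Set.union_sdiff_self]; exact Set.subset_union_right)
      _ ≤ _ := measure_union_le _ _
      _ = _ := by rw [h0, add_zero]
  have hder : ∀ θ ∈ anglePeriod P, HasDerivAt γ _ θ := fun θ hθ =>
    h.extend_hasDerivAt hn (hmem θ) hθ.2
  have hγc : ContinuousOn γ (anglePeriod P) := fun θ hθ =>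
    (hder θ hθ).continuousAt.continuousWithinAt
  have hfin : volume (anglePeriod P) ≠ ∞ :=
    ((measure_mono Set.inter_subset_left).trans_lt measure_Ioo_lt_top).ne
  rw [hlen, hausdorffMeasure_image_eq_lintegral (isOpen_anglePeriod hn) hfin hder ?_ ?_]
  · refine setLIntegral_congr_fun (isOpen_anglePeriod hn).measurableSet fun θ hθ => ?_
    rw [← ofReal_norm, norm_mul, Complex.norm_I, mul_one, norm_div, norm_mul, norm_exp_line hn,
      Complex.norm_natCast]
    rfl
  · refine (ContinuousOn.div (by fun_prop) (P.derivative.continuous.comp_continuousOn hγc)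
      fun θ hθ => ?_).mul continuousOn_const
    exact h.extend_deriv_ne hn (hmem θ) (by rw [him]; exact hθ.2)
  · intro θ hθ θ' hθ' heq
    have h1 := h.extend_exp_eq_exp hn (hmem θ) (by rw [him]; exact hθ.2) (hmem θ')
      (by rw [him]; exact hθ'.2) heq
    obtain ⟨k, hk⟩ := Complex.exp_eq_exp_iff_exists_int.1 h1
    have h2 : θ = θ' + k * (2 * Real.pi) := by
      have := congrArg Complex.im hk
      simpa using this
    have hpi := Real.two_pi_pos
    have hk0 : k = 0 := by
      have l1 : (k : ℝ) * (2 * Real.pi) < 1 * (2 * Real.pi) := by linarith [hθ.1.2, hθ'.1.1]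
      have l2 : (-1) * (2 * Real.pi) < (k : ℝ) * (2 * Real.pi) := by linarith [hθ.1.1, hθ'.1.2]
      have l3 : (k : ℝ) < 1 := lt_of_mul_lt_mul_right l1 hpi.le
      have l4 : (-1 : ℝ) < k := lt_of_mul_lt_mul_right l2 hpi.le
      have l5 : k < 1 := by exact_mod_cast l3
      have l6 : -1 < k := by exact_mod_cast l4
      omega
    rw [h2, hk0]
    simp

theorem lengthDensity_nonneg (t θ : ℝ) : 0 ≤ lengthDensity P Φ t θ := by
  unfold lengthDensity; positivity

theorem continuousOn_lengthDensity (h : IsExpParam P Φ) (hn : P.natDegree ≠ 0) {t : ℝ}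
    (ht : maxCritValue P ≤ t) : ContinuousOn (lengthDensity P Φ t) (anglePeriod P) := by
  have hγc : ContinuousOn (fun θ : ℝ => extendFrom (logExtDisk P) Φ ((t / P.natDegree : ℝ) +
      θ * Complex.I)) (anglePeriod P) := fun θ hθ =>
    (h.extend_hasDerivAt hn (mem_closedLogExtDisk hn ht θ) hθ.2).continuousAt.continuousWithinAt
  refine continuousOn_const.div (P.derivative.continuous.comp_continuousOn hγc).norm fun θ hθ => ?_
  exact norm_ne_zero_iff.2 (h.extend_deriv_ne hn (mem_closedLogExtDisk hn ht θ) (by simpa using hθ.2))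

theorem exists_lengthDensity_le (h : IsExpParam P Φ) (hn : P.natDegree ≠ 0) {T : ℝ}
    (hT : maxCritValue P ≤ T) :
    ∃ g : ℝ → ℝ, IntegrableOn g (anglePeriod P) ∧ ∀ t ∈ Set.Icc T (T + 1), ∀ θ ∈ anglePeriod P,
      lengthDensity P Φ t θ ≤ g θ := by
  obtain ⟨C, hC, hCle⟩ := exists_pow_le_of_isCompact hn (isCompact_norm_eval_le hn (Real.exp (T + 1)))
  have hn' : (0 : ℝ) < P.natDegree := by exact_mod_cast Nat.pos_of_ne_zero hn
  set n := P.natDegree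
  set β : ℝ := (n - 1 : ℕ) / n
  have hβ0 : 0 ≤ β := by positivity
  have hβ1 : β < 1 := by
    rw [div_lt_one hn']
    exact_mod_cast Nat.sub_lt (Nat.pos_of_ne_zero hn) one_pos
  set V := (finite_critValues hn).toFinset
  set D : ℝ := n * Real.exp (T + 1) * (C ^ (1 / n : ℝ) * Real.exp T ^ (-β))
  refine ⟨fun θ => D * ∑ v ∈ V, |Real.sin (n * θ - v.arg)| ^ (-β), ?_, fun t ht θ hθ => ?_⟩
  · refine Integrable.const_mul (integrable_finsetSum _ fun v _ => ?_) _
    have h1 := intervalIntegrable_abs_sin_mul_sub_rpow hβ0 hβ1 hn v.arg 0 (2 * Real.pi)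
    rw [intervalIntegrable_iff_integrableOn_Ioo_of_le Real.two_pi_pos.le] at h1
    exact h1.mono_set Set.inter_subset_left
  · have htc : maxCritValue P ≤ t := hT.trans (by exact_mod_cast ht.1)
    have hmem := mem_closedLogExtDisk hn htc θ
    have him : ((t / P.natDegree : ℝ) + θ * Complex.I : ℂ).im = θ := by simp
    have hre : n * ((t / P.natDegree : ℝ) + θ * Complex.I : ℂ).re = t := by
      simp only [Complex.add_re, Complex.ofReal_re, Complex.re_ofReal_mul, Complex.I_re, mul_zero,
        add_zero]
      exact mul_div_cancel₀ _ hn'.ne'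
    have hev := h.extend_eval_eq hn hmem (by rw [him]; exact hθ.2)
    have hdne := h.extend_deriv_ne hn hmem (by rw [him]; exact hθ.2)
    unfold lengthDensity
    set z := extendFrom (logExtDisk P) Φ ((t / P.natDegree : ℝ) + θ * Complex.I)
    obtain ⟨v, hv, hle⟩ := hCle z (by
      simp only [Set.mem_ofPred_eq]
      rw [hev, norm_exp_line hn]
      exact Real.exp_le_exp.2 ht.2)
    have hsin := exp_mul_abs_sin_le n ((t / P.natDegree : ℝ) + θ * Complex.I) v
    rw [hre, him, ← hev] at hsin
    set x := |Real.sin (n * θ - v.arg)|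
    have hx : 0 < x := abs_pos.2 (hθ.2 v hv)
    have hX : Real.exp T * x ≤ ‖P.eval z - v‖ := by
      refine le_trans ?_ hsin
      gcongr
      exact ht.1
    set d := ‖P.derivative.eval z‖
    have hd : 0 < d := norm_pos_iff.2 hdne
    have h1 : (Real.exp T * x) ^ (n - 1) ≤ C * d ^ n := le_trans (by gcongr) hle
    have h2 : (Real.exp T * x) ^ β ≤ C ^ (1 / n : ℝ) * d := by
      have := Real.rpow_le_rpow (by positivity) h1 (by positivity : (0 : ℝ) ≤ 1 / n)
      rw [Real.mul_rpow hC.le (by positivity), ← Real.rpow_natCast, ← Real.rpow_natCast,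
        ← Real.rpow_mul (by positivity), ← Real.rpow_mul hd.le, mul_one_div, mul_one_div,
        div_self hn'.ne', Real.rpow_one] at this
      exact this
    have h3 : 1 / d ≤ C ^ (1 / n : ℝ) * Real.exp T ^ (-β) * x ^ (-β) := by
      rw [mul_assoc, ← Real.mul_rpow (Real.exp_pos T).le hx.le, Real.rpow_neg (by positivity),
        ← div_eq_mul_inv, div_le_div_iff₀ hd (by positivity)]
      linarith
    have h4 : x ^ (-β) ≤ ∑ v ∈ V, |Real.sin (n * θ - v.arg)| ^ (-β) :=
      Finset.single_le_sum (f := fun v : ℂ => |Real.sin (n * θ - v.arg)| ^ (-β))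
        (fun v _ => by positivity) (by simpa [V] using hv)
    calc n * Real.exp t / d = n * Real.exp t * (1 / d) := by ring
      _ ≤ n * Real.exp (T + 1) * (C ^ (1 / n : ℝ) * Real.exp T ^ (-β) * x ^ (-β)) := by
        gcongr
        exact ht.2
      _ = D * x ^ (-β) := by simp only [D]; ring
      _ ≤ _ := mul_le_mul_of_nonneg_left h4 (by positivity)

theorem integrableOn_lengthDensity (h : IsExpParam P Φ) (hn : P.natDegree ≠ 0) {t : ℝ}
    (ht : maxCritValue P ≤ t) : IntegrableOn (lengthDensity P Φ t) (anglePeriod P) := by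
  obtain ⟨g, hg, hle⟩ := h.exists_lengthDensity_le hn ht
  have hA := (isOpen_anglePeriod hn).measurableSet
  refine hg.mono' ((h.continuousOn_lengthDensity hn ht).aestronglyMeasurable hA)
    (ae_restrict_of_forall_mem hA fun θ hθ => ?_)
  rw [Real.norm_of_nonneg (lengthDensity_nonneg t θ)]
  exact hle t ⟨le_rfl, by linarith⟩ θ hθ

theorem length_eq_ofReal (h : IsExpParam P Φ) (hn : P.natDegree ≠ 0) {t : ℝ}
    (ht : maxCritValue P ≤ t) :
    length (levelSet P t) = ENNReal.ofReal (∫ θ in anglePeriod P, lengthDensity P Φ t θ) := by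
  rw [h.length_eq_lintegral hn ht, ofReal_integral_eq_lintegral_ofReal
    (h.integrableOn_lengthDensity hn ht) (Eventually.of_forall fun θ => lengthDensity_nonneg t θ)]

theorem tendsto_integral_lengthDensity (h : IsExpParam P Φ) (hn : P.natDegree ≠ 0) {T : ℝ}
    (hT : maxCritValue P ≤ T) :
    Tendsto (fun t => ∫ θ in anglePeriod P, lengthDensity P Φ t θ) (𝓝[>] T)
      (𝓝 (∫ θ in anglePeriod P, lengthDensity P Φ T θ)) := by
  obtain ⟨g, hg, hle⟩ := h.exists_lengthDensity_le hn hT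
  have hA := (isOpen_anglePeriod hn).measurableSet
  have hnear : ∀ᶠ t in 𝓝[>] T, t ∈ Set.Icc T (T + 1) := by
    filter_upwards [Ioo_mem_nhdsGT (by linarith : T < T + 1)] with t ht using ⟨ht.1.le, ht.2.le⟩
  refine tendsto_integral_filter_of_dominated_convergence g ?_ ?_ hg ?_
  · filter_upwards [hnear] with t ht
    exact (h.continuousOn_lengthDensity hn
      (hT.trans (by exact_mod_cast ht.1))).aestronglyMeasurable hA
  · filter_upwards [hnear] with t ht
    refine ae_restrict_of_forall_mem hA fun θ hθ => ?_
    rw [Real.norm_of_nonneg (lengthDensity_nonneg t θ)]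
    exact hle t ht θ hθ
  · refine ae_restrict_of_forall_mem hA fun θ hθ => ?_
    have hw := mem_closedLogExtDisk hn hT θ
    have hg : ((T / P.natDegree : ℝ) + θ * Complex.I : ℂ).im ∈ goodAngles P := by
      simpa using hθ.2
    have hcont : Continuous fun t : ℝ => ((t / P.natDegree : ℝ) + θ * Complex.I : ℂ) := by fun_prop
    have h1 : Tendsto (fun t : ℝ => ((t / P.natDegree : ℝ) + θ * Complex.I : ℂ)) (𝓝[>] T)
        (𝓝[closedLogExtDisk P] ((T / P.natDegree : ℝ) + θ * Complex.I)) := by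
      refine tendsto_nhdsWithin_iff.2 ⟨(hcont.tendsto T).mono_left nhdsWithin_le_nhds, ?_⟩
      filter_upwards [self_mem_nhdsWithin] with t ht
      exact mem_closedLogExtDisk hn (hT.trans (by exact_mod_cast le_of_lt ht)) θ
    have h2 := (h.extend_continuousWithinAt hn hw hg).tendsto.comp h1
    have h3 := ((P.derivative.continuous.tendsto _).comp h2).norm
    have h4 : Tendsto (fun t : ℝ => P.natDegree * Real.exp t) (𝓝[>] T)
        (𝓝 (P.natDegree * Real.exp T)) :=
      ((by fun_prop : Continuous fun t : ℝ => P.natDegree * Real.exp t).tendsto T).mono_left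
        nhdsWithin_le_nhds
    exact h4.div h3 (norm_ne_zero_iff.2 (h.extend_deriv_ne hn hw hg))

end IsExpParam

variable {P : Polynomial ℂ} {Φ s : ℂ → ℂ} {a : ℕ → ℂ}

/-- A power series in `1 / ζ` as a Laurent series. -/
noncomputable def negCoeff (a : ℕ → ℂ) (j : ℤ) : ℂ := if j ≤ 0 then a j.natAbs else 0

theorem negCoeff_neg (a : ℕ → ℂ) (k : ℕ) : negCoeff a (-(k : ℤ)) = a k := by
  simp [negCoeff]

theorem hasSum_negCoeff_iff {E : Type*} [AddCommMonoid E] [TopologicalSpace E] {f : ℤ → E} {b : E}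
    (hf : ∀ j : ℤ, 0 < j → f j = 0) :
    HasSum f b ↔ HasSum (fun k : ℕ => f (-(k : ℤ))) b := by
  have hinj : Function.Injective fun k : ℕ => -(k : ℤ) := fun k l h => by simpa using h
  refine (hinj.hasSum_iff fun j hj => hf j ?_).symm
  by_contra! h
  exact hj ⟨j.natAbs, by simp only; omega⟩

theorem isLaurentAtInfty_negCoeff (hn : P.natDegree ≠ 0)
    (ha : ∀ ζ ∈ extDisk P, HasSum (fun k => a k * ζ⁻¹ ^ k) (s ζ)) :
    IsLaurentAtInfty s (negCoeff a) := by
  filter_upwards [eventually_mem_extDisk hn] with ζ hζ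
  rw [hasSum_negCoeff_iff fun j hj => by simp [negCoeff, not_le.2 hj]]
  simpa [negCoeff_neg] using ha ζ hζ

theorem circle_mem_extDisk (hn : P.natDegree ≠ 0) {t : ℝ} (ht : maxCritValue P < t) (θ : ℝ) :
    ((t / P.natDegree : ℝ) + θ * Complex.I : ℂ) ∈ logExtDisk P ∧
    (Real.exp (t / P.natDegree) : ℂ) * Complex.exp (θ * Complex.I) =
      Complex.exp ((t / P.natDegree : ℝ) + θ * Complex.I) := by
  have hn' : (P.natDegree : ℝ) ≠ 0 := by exact_mod_cast hn
  constructor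
  · simp only [logExtDisk, Set.mem_ofPred_eq, Complex.add_re, Complex.ofReal_re,
      Complex.re_ofReal_mul, Complex.I_re, mul_zero, add_zero]
    rwa [mul_div_cancel₀ _ hn']
  · rw [Complex.exp_add, Complex.ofReal_exp]

/-- Parseval's identity on the circles outside the largest critical level. -/
theorem hasSum_sq_coeff (hn : P.natDegree ≠ 0) (hs : ContinuousOn s (extDisk P))
    (ha : ∀ ζ ∈ extDisk P, HasSum (fun k => a k * ζ⁻¹ ^ k) (s ζ)) {t : ℝ}
    (ht : maxCritValue P < t) :
    HasSum (fun k => term (negCoeff a) P.natDegree t k) ((2 * Real.pi)⁻¹ *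
      ∫ θ in (0 : ℝ)..(2 * Real.pi),
        ‖s (Real.exp (t / P.natDegree) * Complex.exp (θ * Complex.I))‖ ^ 2) := by
  have hmem : ∀ θ : ℝ, (Real.exp (t / P.natDegree) : ℂ) * Complex.exp (θ * Complex.I) ∈ extDisk P :=
    fun θ => by
      rw [(circle_mem_extDisk hn ht θ).2, exp_mem_extDisk_iff hn]
      exact (circle_mem_extDisk hn ht θ).1
  have hpos := Real.exp_pos (t / P.natDegree)
  have h1 := hasSum_sq_of_hasSum (c := negCoeff a) (r := Real.exp (t / P.natDegree))
    (f := fun θ => s (Real.exp (t / P.natDegree) * Complex.exp (θ * Complex.I)))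
    (hs.comp_continuous (by fun_prop) hmem) (fun θ => by
      rw [hasSum_negCoeff_iff fun j hj => by simp [negCoeff, not_le.2 hj]]
      simpa only [negCoeff_neg, zpow_neg, zpow_natCast, inv_pow] using ha _ (hmem θ))
  rw [hasSum_negCoeff_iff fun j hj => by simp [negCoeff, not_le.2 hj]] at h1
  refine h1.congr_fun fun k => ?_
  rw [term, norm_mul, mul_pow, norm_zpow, Complex.norm_real, Real.norm_of_nonneg hpos.le, zpow_neg,
    zpow_natCast, ← Real.exp_nat_mul, ← Real.exp_neg, ← Real.exp_nat_mul]
  congr 2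
  push_cast
  ring

theorem IsExpParam.integral_lengthDensity (h : IsExpParam P Φ) (hn : P.natDegree ≠ 0)
    (hs : IsSqrtDeriv P (fun ζ => Φ (Complex.log ζ)) s) {t : ℝ} (ht : maxCritValue P < t) :
    ∫ θ in anglePeriod P, lengthDensity P Φ t θ = Real.exp (t / P.natDegree) *
      ∫ θ in (0 : ℝ)..(2 * Real.pi),
        ‖s (Real.exp (t / P.natDegree) * Complex.exp (θ * Complex.I))‖ ^ 2 := by
  have hn' : (P.natDegree : ℝ) ≠ 0 := by exact_mod_cast hn
  rw [intervalIntegral.integral_of_le Real.two_pi_pos.le, integral_Ioc_eq_integral_Ioo,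
    ← setIntegral_congr_set (anglePeriod_ae_eq hn), ← integral_const_mul]
  refine setIntegral_congr_fun (isOpen_anglePeriod hn).measurableSet fun θ _ => ?_
  obtain ⟨hw, he⟩ := circle_mem_extDisk hn ht θ
  have hζ := (exp_mem_extDisk_iff hn).2 hw
  rw [he, ← norm_pow, hs.sq_eq _ hζ, (h.isExteriorMap hn).deriv_eq hζ]
  have hΦ : Φ (Complex.log (Complex.exp ((t / P.natDegree : ℝ) + θ * Complex.I))) =
      Φ ((t / P.natDegree : ℝ) + θ * Complex.I) :=
    (h.eq_iff hn (log_mem_logExtDisk hn hζ) hw).2 (Complex.exp_log (Complex.exp_ne_zero _))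
  rw [lengthDensity, h.extend_eq hw, hΦ, norm_div, norm_mul, Complex.norm_natCast, norm_pow,
    Complex.norm_exp]
  simp only [Complex.add_re, Complex.ofReal_re, Complex.re_ofReal_mul, Complex.I_re, mul_zero,
    add_zero]
  have : Real.exp t = Real.exp (t / P.natDegree) * Real.exp (t / P.natDegree) ^ (P.natDegree - 1) := by
    rw [← pow_succ', Nat.sub_add_cancel (Nat.pos_of_ne_zero hn), ← Real.exp_nat_mul,
      mul_div_cancel₀ _ hn']
  rw [this]
  ring

theorem term_nonneg (c : ℤ → ℂ) (n : ℕ) (t : ℝ) (k : ℕ) : 0 ≤ term c n t k := by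
  unfold term; positivity

theorem term_anti (c : ℤ → ℂ) (n : ℕ) {T t : ℝ} (hTt : T ≤ t) (k : ℕ) : term c n t k ≤ term c n T k := by
  unfold term
  gcongr ?_ * Real.exp (?_ / _)
  nlinarith [Nat.cast_nonneg (α := ℝ) k]

/-- The length formula together with the convergence of the series. -/
theorem IsExpParam.hasSum_length (h : IsExpParam P Φ) (hn : P.natDegree ≠ 0)
    (hs : IsSqrtDeriv P (fun ζ => Φ (Complex.log ζ)) s)
    (ha : ∀ ζ ∈ extDisk P, HasSum (fun k => a k * ζ⁻¹ ^ k) (s ζ)) {t : ℝ}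
    (ht : maxCritValue P ≤ t) :
    HasSum (fun k => term (negCoeff a) P.natDegree t k)
      ((2 * Real.pi * Real.exp (t / P.natDegree))⁻¹ *
        ∫ θ in anglePeriod P, lengthDensity P Φ t θ) := by
  have hgt : ∀ t : ℝ, maxCritValue P < t → HasSum (fun k => term (negCoeff a) P.natDegree t k)
      ((2 * Real.pi * Real.exp (t / P.natDegree))⁻¹ *
        ∫ θ in anglePeriod P, lengthDensity P Φ t θ) := fun t ht => by
    rw [h.integral_lengthDensity hn hs ht, mul_inv, mul_assoc,
      inv_mul_cancel_left₀ (Real.exp_pos _).ne']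
    exact hasSum_sq_coeff hn hs.holo.continuousOn ha ht
  rcases ht.lt_or_eq with hlt | heq
  · exact hgt t hlt
  have hgt' : ∀ t' > t, HasSum (fun k => term (negCoeff a) P.natDegree t' k)
      ((2 * Real.pi * Real.exp (t' / P.natDegree))⁻¹ *
        ∫ θ in anglePeriod P, lengthDensity P Φ t' θ) := fun t' ht' =>
    hgt t' (ht.trans_lt (by exact_mod_cast ht'))
  have hlim : Tendsto (fun t' => (2 * Real.pi * Real.exp (t' / P.natDegree))⁻¹ *
      ∫ θ in anglePeriod P, lengthDensity P Φ t' θ) (𝓝[>] t)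
      (𝓝 ((2 * Real.pi * Real.exp (t / P.natDegree))⁻¹ *
        ∫ θ in anglePeriod P, lengthDensity P Φ t θ)) := by
    refine Tendsto.mul ?_ (h.tendsto_integral_lengthDensity hn ht)
    have hc : Continuous fun t' : ℝ => (2 * Real.pi * Real.exp (t' / P.natDegree))⁻¹ :=
      Continuous.inv₀ (by fun_prop) fun t' => by positivity
    exact (hc.tendsto t).mono_left nhdsWithin_le_nhds
  have hterm : ∀ k, Tendsto (fun t' => term (negCoeff a) P.natDegree t' k) (𝓝[>] t)
      (𝓝 (term (negCoeff a) P.natDegree t k)) := fun k => by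
    have hc : Continuous fun t' : ℝ => term (negCoeff a) P.natDegree t' k := by
      unfold term; fun_prop
    exact (hc.tendsto t).mono_left nhdsWithin_le_nhds
  have hsum : Summable fun k => term (negCoeff a) P.natDegree t k := by
    refine summable_of_sum_le (c := (2 * Real.pi * Real.exp (t / P.natDegree))⁻¹ *
      ∫ θ in anglePeriod P, lengthDensity P Φ t θ) (fun k => term_nonneg _ _ _ _) fun F => ?_
    refine le_of_tendsto_of_tendsto (tendsto_finsetSum F fun k _ => hterm k) hlim ?_
    filter_upwards [self_mem_nhdsWithin] with t' ht'
    exact sum_le_hasSum F (fun k _ => term_nonneg _ _ _ _) (hgt' t' ht')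
  have hlim2 : Tendsto (fun t' => ∑' k, term (negCoeff a) P.natDegree t' k) (𝓝[>] t)
      (𝓝 (∑' k, term (negCoeff a) P.natDegree t k)) := by
    refine tendsto_tsum_of_dominated_convergence hsum hterm ?_
    filter_upwards [self_mem_nhdsWithin] with t' ht' k
    rw [Real.norm_of_nonneg (term_nonneg _ _ _ _)]
    exact term_anti _ _ (le_of_lt ht') k
  have heq2 := tendsto_nhds_unique (hlim2.congr' (by
    filter_upwards [self_mem_nhdsWithin] with t' ht'
    exact (hgt' t' ht').tsum_eq)) hlim
  rw [← heq2]
  exact hsum.hasSum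

theorem IsExteriorMap.exists_norm_deriv_le {φ : ℂ → ℂ} (h : IsExteriorMap P φ)
    (hn : P.natDegree ≠ 0) (hbot : maxCritValue P = ⊥) :
    ∃ B : ℝ, ∀ ζ ∈ extDisk P, ‖ζ‖ ≤ 1 → ‖deriv φ ζ‖ ≤ B := by
  obtain ⟨C, hC, hCle⟩ := exists_pow_le_of_isCompact hn (isCompact_norm_eval_le hn 1)
  have hcrit : ∀ v ∈ critValues P, v = 0 := by
    rintro v (rfl | ⟨z, hz, rfl⟩)
    · rfl
    · have h1 : logAbs P z ≤ maxCritValue P := le_sSup ⟨z, hz, rfl⟩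
      rw [hbot, le_bot_iff, logAbs, ENNReal.log_eq_bot_iff, enorm_eq_zero] at h1
      exact h1
  refine ⟨max 1 (P.natDegree ^ P.natDegree * C), fun ζ hζ hζ1 => ?_⟩
  obtain ⟨v, hv, hle⟩ := hCle (φ ζ) (by
    simp only [Set.mem_ofPred_eq]
    rw [h.eval_eq ζ hζ, norm_pow]
    exact pow_le_one₀ (norm_nonneg _) hζ1)
  rw [hcrit v hv, sub_zero, h.eval_eq ζ hζ, norm_pow] at hle
  have hd : 0 < ‖P.derivative.eval (φ ζ)‖ := norm_pos_iff.2 (h.deriv_ne ζ hζ)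
  have h2 : ‖deriv φ ζ‖ ^ P.natDegree ≤ P.natDegree ^ P.natDegree * C := by
    rw [h.deriv_eq hζ, norm_div, norm_mul, Complex.norm_natCast, norm_pow, div_pow, mul_pow,
      div_le_iff₀ (by positivity), mul_assoc, ← pow_mul, mul_comm (P.natDegree - 1), pow_mul]
    gcongr
  rcases le_or_gt ‖deriv φ ζ‖ 1 with h3 | h3
  · exact h3.trans (le_max_left _ _)
  · exact ((le_self_pow₀ h3.le hn).trans h2).trans (le_max_right _ _)

/-- If all critical values vanish, then `√φ'` is constant. -/
theorem IsExteriorMap.coeff_eq_zero {φ : ℂ → ℂ} (h : IsExteriorMap P φ) (hn : P.natDegree ≠ 0)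
    (hbot : maxCritValue P = ⊥) (hs : IsSqrtDeriv P φ s)
    (ha : ∀ ζ ∈ extDisk P, HasSum (fun k => a k * ζ⁻¹ ^ k) (s ζ)) {k : ℕ} (hk : k ≠ 0) :
    a k = 0 := by
  obtain ⟨B, hB⟩ := h.exists_norm_deriv_le hn hbot
  have hn' : (0 : ℝ) < P.natDegree := by exact_mod_cast Nat.pos_of_ne_zero hn
  have hle : ∀ t : ℝ, t ≤ 0 → ‖a k‖ ^ 2 ≤ B * Real.exp (2 * k * t / P.natDegree) := by
    intro t ht
    have htlt : maxCritValue P < t := by rw [hbot]; exact EReal.bot_lt_coe t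
    have h1 := hasSum_sq_coeff hn hs.holo.continuousOn ha htlt
    have h2 := le_hasSum h1 k fun j _ => term_nonneg _ _ _ _
    have h3 : (2 * Real.pi)⁻¹ * ∫ θ in (0 : ℝ)..(2 * Real.pi),
        ‖s (Real.exp (t / P.natDegree) * Complex.exp (θ * Complex.I))‖ ^ 2 ≤ B := by
      rw [inv_mul_le_iff₀ Real.two_pi_pos, mul_comm (2 * Real.pi)]
      have := intervalIntegral.norm_integral_le_of_norm_le_const (a := 0) (b := 2 * Real.pi) (C := B)
        (f := fun θ : ℝ => ‖s (Real.exp (t / P.natDegree) * Complex.exp (θ * Complex.I))‖ ^ 2)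
        fun θ _ => by
          obtain ⟨hw, he⟩ := circle_mem_extDisk hn htlt θ
          have hζ := (exp_mem_extDisk_iff hn).2 hw
          rw [norm_pow, norm_norm, ← norm_pow, he, hs.sq_eq _ hζ]
          refine hB _ hζ ?_
          rw [← he, norm_mul, Complex.norm_exp_ofReal_mul_I, mul_one, Complex.norm_real,
            Real.norm_of_nonneg (Real.exp_pos _).le, Real.exp_le_one_iff]
          exact div_nonpos_of_nonpos_of_nonneg ht hn'.le
      rw [sub_zero, abs_of_pos Real.two_pi_pos] at this
      exact (le_abs_self _).trans this
    have h4 := h2.trans h3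
    rw [term, negCoeff_neg] at h4
    have h5 : -2 * k * t / P.natDegree = -(2 * k * t / P.natDegree) := by ring
    rwa [h5, Real.exp_neg, ← div_eq_mul_inv, div_le_iff₀ (Real.exp_pos _)] at h4
  have hlim : Tendsto (fun t : ℝ => B * Real.exp (2 * k * t / P.natDegree)) atBot (𝓝 (B * 0)) := by
    refine (Real.tendsto_exp_atBot.comp ?_).const_mul B
    have hk' : (0 : ℝ) < k := by exact_mod_cast Nat.pos_of_ne_zero hk
    have : Tendsto (fun t : ℝ => 2 * k / P.natDegree * t) atBot atBot :=
      tendsto_id.const_mul_atBot (by positivity)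
    refine this.congr fun t => by ring
  rw [mul_zero] at hlim
  have h6 : ‖a k‖ ^ 2 ≤ 0 := ge_of_tendsto hlim (by
    filter_upwards [eventually_le_atBot 0] with t ht using hle t ht)
  have h7 : ‖a k‖ = 0 := by
    have := le_antisymm h6 (sq_nonneg _)
    simpa using this
  exact norm_eq_zero.1 h7

end Lemniscate

theorem mainTheorem5 (n : ℕ) (hn : 1 ≤ n) (P : Polynomial ℂ) (hP : P.Monic)
    (hdeg : P.natDegree = n) :
    (∃ (F φ s : ℂ → ℂ) (c : ℤ → ℂ), Lemniscate.IsLaurentData P F φ s c) ∧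
    ∀ (F φ s : ℂ → ℂ) (c : ℤ → ℂ), Lemniscate.IsLaurentData P F φ s c →
      (∀ ζ ∈ Lemniscate.extDisk P, P.eval (φ ζ) = ζ ^ n) ∧
      (∀ t : ℝ, Lemniscate.maxCritValue P ≤ (t : EReal) →
        Summable (fun k : ℕ => Lemniscate.term c n t (k + 2)) ∧
        Lemniscate.length (Lemniscate.levelSet P t) =
          ENNReal.ofReal (2 * Real.pi * Real.exp (t / n) *
            (1 + ∑' k : ℕ, Lemniscate.term c n t (k + 2)))) ∧
      (∀ T : ℝ, Lemniscate.maxCritValue P = (T : EReal) →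
        Summable (fun k : ℕ => Lemniscate.term c n T (k + 2))) ∧
      (Lemniscate.maxCritValue P = ⊥ → ∀ k : ℕ, 2 ≤ k → c (-(k : ℤ)) = 0) := by
  subst hdeg
  have hn0 : P.natDegree ≠ 0 := by omega
  obtain ⟨Φ, hΦ⟩ := Lemniscate.exists_isExpParam hP hn0
  have hφ := hΦ.isExteriorMap hn0
  obtain ⟨F₀, hF₀, hinv₀⟩ := hφ.exists_rootBranch hn0
  obtain ⟨s₀, a, hs₀, ha0, ha1, ha⟩ := hφ.exists_sqrt hn0
  have hLaurent := Lemniscate.isLaurentAtInfty_negCoeff hn0 ha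
  refine ⟨⟨F₀, _, s₀, _, hF₀, hinv₀, hs₀, hLaurent⟩, fun F φ s c h => ?_⟩
  have hFeq := h.root.eqOn hn0 (hφ.isPreconnected_extDomain hn0) hF₀
  have hφeq : Set.EqOn φ (fun ζ => Φ (Complex.log ζ)) (Lemniscate.extDisk P) := fun ζ hζ => by
    have h1 := h.inverse.maps_inv hζ
    rw [← hinv₀.left_inv _ h1, ← hFeq h1, h.inverse.right_inv ζ hζ]
  have hseq := Lemniscate.IsSqrtDeriv.eqOn hn0 hφ hφeq h.sqrt hs₀
  obtain rfl : c = Lemniscate.negCoeff a := h.laurent.unique hLaurent (by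
    filter_upwards [Lemniscate.eventually_mem_extDisk hn0] with ζ hζ using hseq hζ)
  have hsum : ∀ t : ℝ, Lemniscate.maxCritValue P ≤ (t : EReal) →
      HasSum (fun k : ℕ => Lemniscate.term (Lemniscate.negCoeff a) P.natDegree t (k + 2))
        ((2 * Real.pi * Real.exp (t / P.natDegree))⁻¹ *
          (∫ θ in Lemniscate.anglePeriod P, Lemniscate.lengthDensity P Φ t θ) - 1) := by
    intro t ht
    have h1 := (hasSum_nat_add_iff' 2).2 (hΦ.hasSum_length hn0 hs₀ ha ht)
    have h0 : ∑ i ∈ Finset.range 2,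
        Lemniscate.term (Lemniscate.negCoeff a) P.natDegree t i = 1 := by
      rw [Finset.sum_range_succ, Finset.sum_range_one, Lemniscate.term, Lemniscate.term,
        Lemniscate.negCoeff_neg, Lemniscate.negCoeff_neg, ha0, ha1]
      simp
    rwa [h0] at h1
  refine ⟨fun ζ hζ => ?_, fun t ht => ⟨(hsum t ht).summable, ?_⟩,
    fun T hT => (hsum T hT.le).summable, fun hbot k hk => ?_⟩
  · rw [hφeq hζ]
    exact hφ.eval_eq ζ hζ
  · rw [(hsum t ht).tsum_eq, hΦ.length_eq_ofReal hn0 ht, add_sub_cancel, mul_inv_cancel_left₀]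
    positivity
  · rw [Lemniscate.negCoeff_neg]
    exact hφ.coeff_eq_zero hn0 hbot hs₀ ha (by omega)
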